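/- Let $n\ge 2$ and $1\le k\le n-1$. Let $\Omega\subset\mathbb{R}^n$ be an open set with a simplicial subdivision $\mathcal{G}_h$: a finite, pure $n$-dimensional simplicial complex whose union is $\overline\Omega$ and whose open $n$-simplices (the cells $T$) lie in $\Omega$ (the last condition is automatic if $\Omega$ is a Lipschitz domain). Let $\star$ be the Hodge star with $(\star\omega)\wedge\omega=|\omega|^2\,dx^1\wedge\dots\wedge dx^n$, let $\mathbf d$ be the (weak) exterior derivative, and let $\boldsymbol\delta_k=(-1)^{kn}\star\mathbf d\,\star$ be the codifferential on $k$-forms, which is the formal adjoint of $\mathbf d$; $\mathbf d_h$ and $\boldsymbol\delta_{k,h}$ denote these operators applied cell by cell. $\langle\cdot,\cdot\rangle$ is the $L^2(\Omega)$ inner product of forms, and $H\Lambda^k=\{\omega\in L^2\Lambda^k(\Omega):\mathbf d\omega\in L^2\Lambda^{k+1}(\Omega)\}$. Let $\mathcal P_0\Lambda^k$ be the $k$-forms with constant coefficients, and let $\kappa$ be the Koszul operator (contraction with the vector field $x$). For a cell $T$ let $c_T$ be its centre of mass, $\tilde x=x-c_T$, and let $\kappa_T$ be contraction with the vector field $\tilde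 x$. Put $\mathcal P_1^-\Lambda^k=\mathcal P_0\Lambda^k+\kappa(\mathcal P_0\Lambda^{k+1})$, $\mathcal P_1^{*,-}\Lambda^k=\star(\mathcal P_1^-\Lambda^{n-k})$, and $$\mathcal H^2_{\boldsymbol\delta}\Lambda^k(T)=\mathrm{span}\Big\{\sum_{j=1}^k\big[(\tilde x^{\alpha_j})^2-c^{\alpha_j}\big]\,dx^{\alpha_1}\wedge\dots\wedge dx^{\alpha_k}:\ 1\le\alpha_1<\dots<\alpha_k\le n\Big\},$$ where $c^{i}$ is the mean value of $(\tilde x^{i})^2$ over $T$, and $$\mathbf P^{m+\delta}_{d\cap\delta}\Lambda^k(T)=\mathcal P_0\Lambda^k+\kappa_T(\mathcal P_0\Lambda^{k+1})+\star\kappa_T\star(\mathcal P_0\Lambda^{k-1})+\mathcal H^2_{\boldsymbol\delta}\Lambda^k(T).$$ For a family of local spaces, $(\mathcal G_h)$ denotes the space of $L^2$ forms on $\Omega$ whose restriction to each cell $T$ lies in the local space of $T$. Define the conforming Whitney forms $\mathbf W_h\Lambda^k=\mathcal P_1^-\Lambda^k(\mathcal G_h)\cap H\Lambda^k$, the discrete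 harmonic forms $$\mathfrak H_h\Lambda^k=\{\omega\in\mathbf W_h\Lambda^k:\ \mathbf d\omega=0,\ \langle\omega,\mathbf d\tau\rangle=0\ \ \forall\,\tau\in\mathbf W_h\Lambda^{k-1}\},$$ the space $$\mathbf W^{*,abc}_{h0}\Lambda^{k+1}=\{\eta\in\mathcal P_1^{*,-}\Lambda^{k+1}(\mathcal G_h):\ \langle\boldsymbol\delta_{k+1,h}\eta,\tau\rangle-\langle\eta,\mathbf d\tau\rangle=0\ \ \forall\,\tau\in\mathbf W_h\Lambda^{k}\},$$ and the nonconforming space $\mathbf V^{m,+\delta}_{d\cap\delta}\Lambda^k$ of all $\mu\in\mathbf P^{m+\delta}_{d\cap\delta}\Lambda^k(\mathcal G_h)$ such that $$\langle\mathbf d_h\mu,\eta\rangle-\langle\mu,\boldsymbol\delta_{k+1,h}\eta\rangle=0\ \ \forall\,\eta\in\mathbf W^{*,abc}_{h0}\Lambda^{k+1},\qquad \langle\boldsymbol\delta_{k,h}\mu,\tau\rangle-\langle\mu,\mathbf d\tau\rangle=0\ \ \forall\,\tau\in\mathbf W_h\Lambda^{k-1}.$$ Then the kernel of $\mathbf T_h=(\mathbf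 d_h,\boldsymbol\delta_{k,h})$ on this space is exactly the discrete harmonic space: $$\{\mu\in\mathbf V^{m,+\delta}_{d\cap\delta}\Lambda^k:\ \mathbf T_h\mu=0\}=\mathfrak H_h\Lambda^k.$$ -/

import Mathlib

open MeasureTheory

noncomputable section

namespace HodgeFEM

/-! ### Forms with constant coefficients and their algebra -/

/-- The ambient space `ℝⁿ`. -/
abbrev Pt (n : ℕ) := EuclideanSpace ℝ (Fin n)

/-- The exterior algebra of `(ℝⁿ)*`, in coordinates: `a α` is the coefficient of
`dx^{α₁} ∧ ⋯ ∧ dx^{αₖ}`, where `α = {α₁ < ⋯ < αₖ}`. The Euclidean structure is the standard one, in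
which these basis forms are orthonormal; the `k`-forms are spanned by the `α` with `α.card = k`. -/
abbrev Cov (n : ℕ) := EuclideanSpace ℝ (Finset (Fin n))

/-- `dx^{α₁} ∧ ⋯ ∧ dx^{αₖ}` for `α = {α₁ < ⋯ < αₖ}`. -/
def dx {n : ℕ} (α : Finset (Fin n)) : Cov n := EuclideanSpace.single α 1

/-- The sign with `dx^α ∧ dx^β = sgn α β • dx^{α ∪ β}` for disjoint `α`, `β`: the parity of the
number of inversions. -/
def sgn {n : ℕ} (α β : Finset (Fin n)) : ℝ :=
  (-1) ^ ((α ×ˢ β).filter fun p => p.2 < p.1).card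

/-- The Hodge star, normalised by `(⋆ a) ∧ a = |a|² dx¹ ∧ ⋯ ∧ dxⁿ`, that is
`⋆ dx^α = sgn αᶜ α • dx^{αᶜ}`. -/
def hodge (n : ℕ) : Cov n →L[ℝ] Cov n :=
  LinearMap.toContinuousLinearMap
    { toFun := fun a => WithLp.toLp 2 fun β => sgn β βᶜ * a βᶜ
      map_add' := fun a b => by ext β; simp [mul_add]
      map_smul' := fun c a => by ext β; simp [mul_left_comm] }

/-! ### Polynomial forms -/

/-- Differential forms on `ℝⁿ` (of arbitrary regularity). -/
abbrev Form (n : ℕ) := Pt n → Cov n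

/-- The pointwise Hodge star. -/
def starForm (n : ℕ) : Form n →ₗ[ℝ] Form n := (hodge n).toLinearMap.compLeft (Pt n)

/-- The Koszul operator with base point `c`: contraction with the vector field `x - c`,
`κ (dx^α) = ∑_j (-1)^(j+1) (x - c)^{α_j} dx^{α ∖ α_j}`. -/
def koszul {n : ℕ} (c : Pt n) : Form n →ₗ[ℝ] Form n where
  toFun ω x := WithLp.toLp 2 fun β => ∑ j ∈ βᶜ, sgn {j} β * (x j - c j) * ω x (insert j β)
  map_add' ω η := by ext x β; simp [mul_add, Finset.sum_add_distrib]
  map_smul' r ω := by ext x β; simp [Finset.mul_sum, mul_left_comm]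

/-- `𝒫₀Λᵏ`: `k`-forms with constant coefficients. -/
def P0 (n k : ℕ) : Submodule ℝ (Form n) :=
  Submodule.span ℝ {ω | ∃ α : Finset (Fin n), α.card = k ∧ ω = fun _ => dx α}

/-- Whitney forms `𝒫₁⁻Λᵏ = 𝒫₀Λᵏ + κ(𝒫₀Λᵏ⁺¹)`. -/
def PMinus (n k : ℕ) : Submodule ℝ (Form n) :=
  P0 n k ⊔ (P0 n (k + 1)).map (koszul 0)

/-- `𝒫₁^{*,-}Λᵏ = ⋆(𝒫₁⁻Λⁿ⁻ᵏ)`. -/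
def PStarMinus (n k : ℕ) : Submodule ℝ (Form n) := (PMinus n (n - k)).map (starForm n)

/-- The centre `c_T` of a cell: `∫_T (xʲ - c_Tʲ) = 0` for all `j`. -/
def centre {n : ℕ} (T : Set (Pt n)) : Pt n := WithLp.toLp 2 fun j => ⨍ x in T, x j

/-- `μ_{δ,T}^α = ∑_{j ∈ α} ((x̃ʲ)² - cʲ) dx^α`, where `x̃ = x - c_T` and `cʲ` is the mean value
of `(x̃ʲ)²` over `T`. -/
def muDelta {n : ℕ} (T : Set (Pt n)) (α : Finset (Fin n)) : Form n := fun x =>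
  (∑ j ∈ α, ((x j - centre T j) ^ 2 - ⨍ y in T, (y j - centre T j) ^ 2)) • dx α

/-- `ℋ²_δΛᵏ(T)`. -/
def HDelta {n : ℕ} (k : ℕ) (T : Set (Pt n)) : Submodule ℝ (Form n) :=
  Submodule.span ℝ {ω | ∃ α : Finset (Fin n), α.card = k ∧ ω = muDelta T α}

/-- The local shape function space for `k ≥ 1`,
`P^{m+δ}_{d∩δ}Λᵏ(T) = 𝒫₀Λᵏ + κ_T(𝒫₀Λᵏ⁺¹) + ⋆κ_T⋆(𝒫₀Λᵏ⁻¹) + ℋ²_δΛᵏ(T)`. -/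
def PmDelta {n : ℕ} (k : ℕ) (T : Set (Pt n)) : Submodule ℝ (Form n) :=
  P0 n k ⊔ (P0 n (k + 1)).map (koszul (centre T))
    ⊔ (P0 n (k - 1)).map (starForm n ∘ₗ koszul (centre T) ∘ₗ starForm n) ⊔ HDelta k T

/-! ### Square integrable forms and weak exterior derivatives -/

/-- The Hilbert space of all square integrable forms on `Ω` (of all degrees together). -/
abbrev L2 {n : ℕ} (Ω : Set (Pt n)) := Lp (Cov n) 2 (volume.restrict Ω)

/-- `L²Λᵏ(Ω)`, the elements that are homogeneous of degree `k`. -/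
def L2k {n : ℕ} (Ω : Set (Pt n)) (k : ℕ) : Set (L2 Ω) :=
  {ω | ∀ᵐ x ∂(volume.restrict Ω), ∀ α : Finset (Fin n), α.card ≠ k → ω x α = 0}

/-- `η = dω` on the open set `U` in the sense of distributions, where
`(dω)_γ = ∑_{j ∈ γ} sgn {j} (γ ∖ j) ∂_j ω_{γ ∖ j}`. -/
def IsWeakD {n : ℕ} (U : Set (Pt n)) (ω η : Form n) : Prop :=
  ∀ φ : Pt n → ℝ, ContDiff ℝ (⊤ : ℕ∞) φ → HasCompactSupport φ → tsupport φ ⊆ U →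
    ∀ γ : Finset (Fin n),
      ∫ x in U, φ x * η x γ =
        -∫ x in U, ∑ j ∈ γ, sgn {j} (γ.erase j) *
          (fderiv ℝ φ x (EuclideanSpace.single j 1) * ω x (γ.erase j))

/-- The exterior derivative in `L²`, taken in the weak sense on each of the open sets `U ∈ 𝒰`
(with value `0` if there is none). -/
def weakD {n : ℕ} {Ω : Set (Pt n)} (𝒰 : Set (Set (Pt n))) (ω : L2 Ω) : L2 Ω :=
  open Classical in
  if h : ∃ η : L2 Ω, ∀ U ∈ 𝒰, IsWeakD U ω η then h.choose else 0

/-- Weak exterior derivatives are unique, so `weakD` does not depend on choices. -/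
theorem weakD_eq {n : ℕ} {Ω : Set (Pt n)} {𝒰 : Set (Set (Pt n))} (hc : 𝒰.Countable)
    (ho : ∀ U ∈ 𝒰, IsOpen U) (hs : ∀ U ∈ 𝒰, U ⊆ Ω) (hΩ : volume (Ω \ ⋃₀ 𝒰) = 0)
    {ω η : L2 Ω} (h : ∀ U ∈ 𝒰, IsWeakD U ω η) : weakD 𝒰 ω = η := by
  classical
  have hex : ∃ η : L2 Ω, ∀ U ∈ 𝒰, IsWeakD U ω η := ⟨η, h⟩
  rw [weakD, dif_pos hex]
  set ζ := hex.choose with hζ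
  have hz : ∀ U ∈ 𝒰, IsWeakD U ω ζ := hex.choose_spec
  have loc : ∀ θ : L2 Ω, ∀ γ, ∀ U ∈ 𝒰, LocallyIntegrable (fun x => θ x γ)
      (volume.restrict U) := by
    intro θ γ U hU
    have h1 : MemLp (fun x => θ x) 2 (volume.restrict U) :=
      (Lp.memLp θ).mono_measure (Measure.restrict_mono_set _ (hs U hU))
    have h2 : LocallyIntegrable (fun x => θ x) (volume.restrict U) :=
      h1.locallyIntegrable (by norm_num)
    intro x
    obtain ⟨s, hs, hi⟩ := h2 x
    exact ⟨s, hs, (EuclideanSpace.proj (𝕜 := ℝ) γ).integrable_comp hi⟩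
  have key : ∀ U ∈ 𝒰, ∀ᵐ x ∂(volume : Measure (Pt n)), x ∈ U → ζ x = η x := by
    intro U hU
    have : ∀ γ, ∀ᵐ x ∂(volume.restrict U), x ∈ U → ζ x γ - η x γ = 0 := by
      intro γ
      refine (ho U hU).ae_eq_zero_of_integral_contDiff_smul_eq_zero
        (((loc ζ γ U hU).sub (loc η γ U hU)).locallyIntegrableOn U) ?_
      intro g hg hgc hgs
      have e := (hz U hU g hg hgc hgs γ).trans (h U hU g hg hgc hgs γ).symm
      have i1 := (loc ζ γ U hU).integrable_smul_left_of_hasCompactSupport hg.continuous hgc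
      have i2 := (loc η γ U hU).integrable_smul_left_of_hasCompactSupport hg.continuous hgc
      simp only [smul_eq_mul] at i1 i2
      simp only [smul_eq_mul, mul_sub]
      rw [integral_sub i1 i2, e, sub_self]
    have h3 := ae_all_iff.2 this
    rw [ae_restrict_iff' (ho U hU).measurableSet] at h3
    filter_upwards [h3] with x hx hxU
    ext γ
    exact sub_eq_zero.1 (hx hxU γ hxU)
  apply Lp.ext
  have h4 : ∀ᵐ x ∂(volume : Measure (Pt n)), ∀ U ∈ 𝒰, x ∈ U → ζ x = η x :=
    (ae_ball_iff hc).2 key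
  have h5 : ∀ᵐ x ∂(volume.restrict Ω), x ∈ ⋃₀ 𝒰 := by
    rw [ae_iff]
    refine le_antisymm (le_trans (le_of_eq ?_) hΩ.le) (zero_le)
    have hm : MeasurableSet {x | ¬ x ∈ ⋃₀ 𝒰} :=
      (isOpen_sUnion ho).measurableSet.compl
    rw [Measure.restrict_apply hm]
    congr 1
    ext x
    simp [and_comm]
  filter_upwards [ae_restrict_of_ae h4, h5] with x hx hx5
  obtain ⟨U, hU, hxU⟩ := hx5
  exact hx U hU hxU

/-- The exterior derivative `d` on `Ω`. -/
def extD {n : ℕ} {Ω : Set (Pt n)} (ω : L2 Ω) : L2 Ω := weakD {Ω} ω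

/-- `HΛᵏ(Ω) = {ω ∈ L²Λᵏ(Ω) : dω ∈ L²}`. -/
def HSpace {n : ℕ} (Ω : Set (Pt n)) (k : ℕ) : Set (L2 Ω) :=
  {ω | ω ∈ L2k Ω k ∧ ∃ η : L2 Ω, IsWeakD Ω ω η}

/-- The Hodge star on `L²`. -/
def starL2 {n : ℕ} {Ω : Set (Pt n)} (ω : L2 Ω) : L2 Ω := (hodge n).compLp ω

/-! ### Simplicial subdivisions -/

/-- A simplicial subdivision of `Ω`: a finite, pure `n`-dimensional simplicial complex with
`closure Ω` as underlying space, whose open `n`-simplices are contained in `Ω`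
(which is automatic if `Ω` is a Lipschitz domain, since then `Ω = interior (closure Ω)`). -/
structure SimplicialSubdivision {n : ℕ} (Ω : Set (Pt n)) extends
    Geometry.SimplicialComplex ℝ (Pt n) where
  finite_faces : faces.Finite
  pure : ∀ s ∈ faces, ∃ t ∈ faces, s ⊆ t ∧ t.card = n + 1
  space_eq : toSimplicialComplex.space = closure Ω
  interior_subset : ∀ s ∈ faces, interior (convexHull ℝ (s : Set (Pt n))) ⊆ Ω

namespace SimplicialSubdivision

variable {n : ℕ} {Ω : Set (Pt n)} (G : SimplicialSubdivision Ω)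

/-- The cells of the subdivision, as open `n`-simplices. -/
def cells : Set (Set (Pt n)) :=
  {T | ∃ s ∈ G.faces, s.card = n + 1 ∧ T = interior (convexHull ℝ (s : Set (Pt n)))}

/-- `∏_T Υ(T)`: the square integrable forms whose restriction to each cell `T` is in `Υ(T)`. -/
def broken (Υ : Set (Pt n) → Submodule ℝ (Form n)) : Set (L2 Ω) :=
  {ω | ∀ T ∈ G.cells, ∃ p ∈ Υ T, ω =ᵐ[volume.restrict T] p}

/-- The piecewise exterior derivative `d_h`. -/
def dh (ω : L2 Ω) : L2 Ω := weakD G.cells ω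

/-- The piecewise codifferential `δ_{k,h} = (-1)^{kn} ⋆ d_h ⋆` on `k`-forms. -/
def deltah (k : ℕ) (ω : L2 Ω) : L2 Ω := (-1 : ℝ) ^ (k * n) • starL2 (G.dh (starL2 ω))

/-- The conforming Whitney forms `W_hΛᵏ = 𝒫₁⁻Λᵏ(𝒢_h) ∩ HΛᵏ(Ω)`. -/
def W (k : ℕ) : Set (L2 Ω) := G.broken (fun _ => PMinus n k) ∩ HSpace Ω k

/-- The discrete harmonic forms `𝔥_hΛᵏ = N(d, W_hΛᵏ) ⊖^⊥ R(d, W_hΛᵏ⁻¹)`, `k ≥ 1`. -/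
def harmonic (k : ℕ) : Set (L2 Ω) :=
  {ω | ω ∈ G.W k ∧ extD ω = 0 ∧ ∀ ζ ∈ extD '' G.W (k - 1), inner ℝ ω ζ = 0}

/-- The accompanied-by-conforming space `W^{*,abc}_{h0}Λᵏ`, `k ≥ 1`. -/
def WStarABC0 (k : ℕ) : Set (L2 Ω) :=
  {η | η ∈ G.broken (fun _ => PStarMinus n k) ∧
    ∀ τ ∈ G.W (k - 1), inner ℝ (G.deltah k η) τ - inner ℝ η (extD τ) = 0}

/-- The nonconforming space `V^{m,+δ}_{d∩δ}Λᵏ`, `k ≥ 1`. -/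
def V (k : ℕ) : Set (L2 Ω) :=
  {μ | μ ∈ G.broken (PmDelta k) ∧
    (∀ η ∈ G.WStarABC0 (k + 1), inner ℝ (G.dh μ) η - inner ℝ μ (G.deltah (k + 1) η) = 0) ∧
    ∀ τ ∈ G.W (k - 1), inner ℝ (G.deltah k μ) τ - inner ℝ μ (extD τ) = 0}

/-- The operator `T_h = (d_h, δ_h)` on `k`-forms. -/
def Th (k : ℕ) (μ : L2 Ω) : L2 Ω × L2 Ω := (G.dh μ, G.deltah k μ)

end SimplicialSubdivision

end HodgeFEM

end

noncomputable section

namespace HodgeFEM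

variable {n : ℕ}

/-! ### Signs -/


/-! On a cell, with x̃ = x - c_T, a shape function is a + x̃ ⌟ b + x̃ ∧ c + ∑ h_α μ^α. Its exterior
derivative is (k+1) b, and its codifferential is -(n-k+1) c - 2 x̃ ⌟ h
(`extSymbol_fderiv_shapeForm`, `coSymbol_fderiv_shapeForm`). If both vanish on the open cell, then b
= 0, the linear part x̃ ⌟ h vanishes, which forces h = 0 because d(x̃ ⌟ h) = k h with k ≥ 1, and
then c = 0. So the kernel of `Th` consists of piecewise constant forms, which are in particular
broken Whitney forms (`exists_const_of_Th_eq_zero`).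

The global part is a duality argument. Consider B(η, τ) = ⟨δ_h η, τ⟩ - ⟨η, d_h τ⟩ for broken forms,
given on T by η = x̃ ∧ u + v and τ = a + x̃ ⌟ b. Since x̃ has mean zero, B(η, τ) = -∑_T |T|
((n-k)⟨u, a⟩ + (k+1)⟨v, b⟩). Hence every linear functional on broken Whitney forms is B(η, ·) for
some η (`exists_representative`). If a kernel element μ were not conforming, some functional would
vanish on the conforming forms but not at μ. Its η lies in `WStarABC0`, so the constraint defining
`V` gives B(η, μ) = 0, a contradiction. Once μ is conforming, d_h μ = dμ, and the second constraint
of `V` with δ_h μ = 0 is the orthogonality to exact forms.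

Conversely, a closed Whitney form has b = 0 on each cell, so it is piecewise constant and δ_h
annihilates it. The two constraints of `V` then reduce to the definition of `WStarABC0` and to
harmonicity. -/

theorem sgn_mul_self (α β : Finset (Fin n)) : sgn α β * sgn α β = 1 := by
  rw [sgn, ← mul_pow]; norm_num

theorem sgn_union_left {α α' : Finset (Fin n)} (h : Disjoint α α') (β : Finset (Fin n)) :
    sgn (α ∪ α') β = sgn α β * sgn α' β := by
  rw [sgn, sgn, sgn, ← pow_add, Finset.union_product, Finset.filter_union,
    Finset.card_union_of_disjoint]
  exact Finset.disjoint_filter_filter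
    (Finset.disjoint_product.2 (Or.inl h))

theorem sgn_union_right (β : Finset (Fin n)) {α α' : Finset (Fin n)} (h : Disjoint α α') :
    sgn β (α ∪ α') = sgn β α * sgn β α' := by
  rw [sgn, sgn, sgn, ← pow_add, Finset.product_union, Finset.filter_union,
    Finset.card_union_of_disjoint]
  exact Finset.disjoint_filter_filter
    (Finset.disjoint_product.2 (Or.inr h))

/-- Disjointness excludes i = j, so each pair (i, j) in α × β is an inversion for exactly one of the
two orders; the two inversion counts add up to the number of pairs. -/
theorem sgn_mul_sgn_swap {α β : Finset (Fin n)} (h : Disjoint α β) :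
    sgn α β * sgn β α = (-1) ^ (α.card * β.card) := by
  have e : ((β ×ˢ α).filter fun p => p.2 < p.1).card =
      ((α ×ˢ β).filter fun p => ¬ p.2 < p.1).card := by
    refine Finset.card_bij (fun p _ => (p.2, p.1)) ?_ ?_ ?_
    · rintro ⟨i, j⟩ hp
      simp only [Finset.mem_filter, Finset.mem_product] at hp ⊢
      exact ⟨⟨hp.1.2, hp.1.1⟩, not_lt.2 hp.2.le⟩
    · rintro ⟨i, j⟩ _ ⟨i', j'⟩ _ hp
      simp only [Prod.mk.injEq] at hp ⊢
      exact ⟨hp.2, hp.1⟩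
    · rintro ⟨i, j⟩ hp
      simp only [Finset.mem_filter, Finset.mem_product, not_lt] at hp
      refine ⟨(j, i), ?_, rfl⟩
      simp only [Finset.mem_filter, Finset.mem_product]
      refine ⟨⟨hp.1.2, hp.1.1⟩, lt_of_le_of_ne hp.2 ?_⟩
      rintro rfl
      exact Finset.disjoint_left.1 h hp.1.1 hp.1.2
  rw [sgn, sgn, ← pow_add, e, Finset.card_filter_add_card_filter_not, Finset.card_product]

/-! ### Homogeneous covectors, contraction and exterior multiplication -/

/-- The constant `k`-forms. -/
def Hom (n k : ℕ) : Submodule ℝ (Cov n) where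
  carrier := {a | ∀ α : Finset (Fin n), α.card ≠ k → a α = 0}
  add_mem' ha hb α hα := by simp [ha α hα, hb α hα]
  zero_mem' _ _ := rfl
  smul_mem' r a ha α hα := by simp [ha α hα]

/-- Contraction `v ⌟ a`, linear in `a` and `v`. -/
def contract : Cov n →ₗ[ℝ] Pt n →ₗ[ℝ] Cov n :=
  LinearMap.mk₂ ℝ
    (fun a v => WithLp.toLp 2 fun β => ∑ j ∈ βᶜ, sgn {j} β * v j * a (insert j β))
    (fun a b v => by ext β; simp [mul_add, Finset.sum_add_distrib])
    (fun r a v => by ext β; simp [Finset.mul_sum, mul_left_comm])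
    (fun a v w => by ext β; simp [mul_add, add_mul, Finset.sum_add_distrib])
    (fun r a v => by ext β; simp [Finset.mul_sum, mul_left_comm, mul_assoc])

/-- Exterior multiplication `v ∧ a`, linear in `a` and `v`. -/
def wedge : Cov n →ₗ[ℝ] Pt n →ₗ[ℝ] Cov n :=
  LinearMap.mk₂ ℝ
    (fun a v => WithLp.toLp 2 fun γ => ∑ j ∈ γ, sgn {j} (γ.erase j) * v j * a (γ.erase j))
    (fun a b v => by ext β; simp [mul_add, Finset.sum_add_distrib])
    (fun r a v => by ext β; simp [Finset.mul_sum, mul_left_comm])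
    (fun a v w => by ext β; simp [mul_add, add_mul, Finset.sum_add_distrib])
    (fun r a v => by ext β; simp [Finset.mul_sum, mul_left_comm, mul_assoc])

theorem contract_apply (a : Cov n) (v : Pt n) (β : Finset (Fin n)) :
    contract a v β = ∑ j ∈ βᶜ, sgn {j} β * v j * a (insert j β) := rfl

theorem wedge_apply (a : Cov n) (v : Pt n) (γ : Finset (Fin n)) :
    wedge a v γ = ∑ j ∈ γ, sgn {j} (γ.erase j) * v j * a (γ.erase j) := rfl

theorem hodge_apply (a : Cov n) (β : Finset (Fin n)) :
    hodge n a β = sgn β βᶜ * a βᶜ := rfl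

theorem contract_mem {k : ℕ} {a : Cov n} (ha : a ∈ Hom n (k + 1)) (v : Pt n) :
    contract a v ∈ Hom n k := by
  intro β hβ
  rw [contract_apply]
  refine Finset.sum_eq_zero fun j hj => ?_
  rw [ha, mul_zero]
  rw [Finset.card_insert_of_notMem (Finset.mem_compl.1 hj)]
  omega

theorem wedge_mem {k : ℕ} {a : Cov n} (ha : a ∈ Hom n k) (v : Pt n) :
    wedge a v ∈ Hom n (k + 1) := by
  intro β hβ
  rw [wedge_apply]
  refine Finset.sum_eq_zero fun j hj => ?_
  rw [ha, mul_zero]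
  have := Finset.card_erase_add_one hj
  omega

theorem hodge_mem {k m : ℕ} (h : k + m = n) {a : Cov n} (ha : a ∈ Hom n k) :
    hodge n a ∈ Hom n m := by
  intro β hβ
  rw [hodge_apply, ha, mul_zero]
  rw [Finset.card_compl, Fintype.card_fin]
  have := β.card_le_univ
  rw [Fintype.card_fin] at this
  omega

theorem hodge_hodge {k m : ℕ} (h : k + m = n) {a : Cov n} (ha : a ∈ Hom n k) :
    hodge n (hodge n a) = (-1 : ℝ) ^ (k * m) • a := by
  ext β
  rw [hodge_apply, hodge_apply, compl_compl, PiLp.smul_apply, smul_eq_mul, ← mul_assoc,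
    sgn_mul_sgn_swap disjoint_compl_right]
  by_cases hβ : β.card = k
  · rw [hβ, Finset.card_compl, hβ, Fintype.card_fin]
    congr 3
    omega
  · rw [ha β hβ]; simp

/-- The sign of j against βᶜ occurs twice and cancels; what remains is the sign of swapping β ∖ j
with βᶜ. This turns ⋆κ⋆ into exterior multiplication, both in `PmDelta` and in `PStarMinus`. -/
theorem hodge_contract_hodge {p q : ℕ} (h : p + q + 1 = n) {a : Cov n} (ha : a ∈ Hom n p)
    (v : Pt n) : hodge n (contract (hodge n a) v) = (-1 : ℝ) ^ (p * q) • wedge a v := by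
  ext β
  rw [hodge_apply, contract_apply, compl_compl, PiLp.smul_apply, wedge_apply, smul_eq_mul,
    Finset.mul_sum, Finset.mul_sum]
  refine Finset.sum_congr rfl fun j hj => ?_
  have e : (insert j βᶜ)ᶜ = β.erase j := by
    ext i; simp [Finset.mem_erase]
  rw [hodge_apply, e]
  by_cases hβ : (β.erase j).card = p
  · have hj' : Disjoint {j} (β.erase j) := by simp
    have hd : Disjoint {j} βᶜ := by simpa using hj
    have hd' : Disjoint (β.erase j) βᶜ :=
      Finset.disjoint_of_subset_left (Finset.erase_subset _ _) disjoint_compl_right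
    have hb : β = {j} ∪ β.erase j := by rw [← Finset.insert_eq, Finset.insert_erase hj]
    have s1 : sgn β βᶜ = sgn {j} βᶜ * sgn (β.erase j) βᶜ := by
      rw [← sgn_union_left hj', ← hb]
    have s2 : sgn (insert j βᶜ) (β.erase j) = sgn {j} (β.erase j) * sgn βᶜ (β.erase j) := by
      rw [Finset.insert_eq, sgn_union_left hd]
    have hc : βᶜ.card = q := by
      have := Finset.card_erase_add_one hj
      rw [Finset.card_compl, Fintype.card_fin]
      omega
    have s3 := sgn_mul_sgn_swap hd'
    rw [hβ, hc] at s3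
    rw [s1, s2, ← s3]
    linear_combination (sgn (β.erase j) βᶜ * sgn βᶜ (β.erase j) * sgn {j} (β.erase j) * v j *
      a (β.erase j)) * sgn_mul_self {j} βᶜ
  · rw [ha _ hβ]; simp

/-! ### Symbols of the exterior derivative and the codifferential -/

/-- The standard basis vector. -/
abbrev basisVec (j : Fin n) : Pt n := EuclideanSpace.single j 1

/-- The exterior derivative of a form in terms of its differential. -/
def extSymbol : (Pt n →L[ℝ] Cov n) →ₗ[ℝ] Cov n where
  toFun A := WithLp.toLp 2 fun γ =>
    ∑ j ∈ γ, sgn {j} (γ.erase j) * A (basisVec j) (γ.erase j)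
  map_add' A B := by ext γ; simp [mul_add, Finset.sum_add_distrib]
  map_smul' r A := by ext γ; simp [Finset.mul_sum, mul_left_comm]

/-- The codifferential of a form in terms of its differential. -/
def coSymbol : (Pt n →L[ℝ] Cov n) →ₗ[ℝ] Cov n where
  toFun A := WithLp.toLp 2 fun β =>
    -∑ j ∈ βᶜ, sgn {j} β * A (basisVec j) (insert j β)
  map_add' A B := by ext γ; simp [mul_add, Finset.sum_add_distrib]; ring
  map_smul' r A := by ext γ; simp [Finset.mul_sum, mul_left_comm]

theorem extSymbol_apply (A : Pt n →L[ℝ] Cov n) (γ : Finset (Fin n)) :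
    extSymbol A γ = ∑ j ∈ γ, sgn {j} (γ.erase j) * A (basisVec j) (γ.erase j) := rfl

theorem coSymbol_apply (A : Pt n →L[ℝ] Cov n) (β : Finset (Fin n)) :
    coSymbol A β = -∑ j ∈ βᶜ, sgn {j} β * A (basisVec j) (insert j β) := rfl

/-- Each j contributes the same term on both sides up to a sign depending only on k and n; the
factor (-1)^(kn) makes that sign -1. All later codifferentials are computed without the star. -/
theorem hodge_extSymbol_hodge {k : ℕ} (hk : 1 ≤ k) (hkn : k ≤ n) (A : Pt n →L[ℝ] Cov n)
    (hA : ∀ v, A v ∈ Hom n k) :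
    (-1 : ℝ) ^ (k * n) • hodge n (extSymbol ((hodge n).comp A)) = coSymbol A := by
  ext β
  rw [PiLp.smul_apply, hodge_apply, extSymbol_apply, coSymbol_apply, smul_eq_mul,
    Finset.mul_sum, Finset.mul_sum, ← Finset.sum_neg_distrib]
  refine Finset.sum_congr rfl fun j hj => ?_
  have e : (βᶜ.erase j)ᶜ = insert j β := by
    ext i; simp
  have hjβ : j ∉ β := Finset.mem_compl.1 hj
  rw [ContinuousLinearMap.comp_apply, hodge_apply, e]
  by_cases hβ : (insert j β).card = k
  · set γ := βᶜ.erase j with hγ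
    have hγc : γ.card = n - k := by
      rw [← compl_compl γ, e, Finset.card_compl, hβ, Fintype.card_fin]
    have hβc : β.card = k - 1 := by
      rw [Finset.card_insert_of_notMem hjβ] at hβ; omega
    have d1 : Disjoint {j} γ := by simp [hγ]
    have d2 : Disjoint {j} β := by simpa using hjβ
    have d3 : Disjoint β γ :=
      Finset.disjoint_of_subset_right (Finset.erase_subset _ _) disjoint_compl_right
    have hb : βᶜ = {j} ∪ γ := by rw [← Finset.insert_eq, Finset.insert_erase hj]
    have s1 : sgn β βᶜ = sgn β {j} * sgn β γ := by rw [← sgn_union_right _ d1, ← hb]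
    have s2 : sgn γ (insert j β) = sgn γ {j} * sgn γ β := by
      rw [Finset.insert_eq, sgn_union_right _ d2]
    have t1 := sgn_mul_sgn_swap d1
    have t2 := sgn_mul_sgn_swap d2
    have t3 := sgn_mul_sgn_swap d3
    rw [Finset.card_singleton, one_mul, hγc] at t1
    rw [Finset.card_singleton, one_mul, hβc] at t2
    rw [hγc, hβc] at t3
    have t2' : sgn β {j} = (-1) ^ (k - 1) * sgn {j} β := by
      rw [← t2]; linear_combination (- sgn β {j}) * sgn_mul_self {j} β
    have par : (-1 : ℝ) ^ (k * n) * ((-1) ^ (k - 1) * (-1) ^ (n - k) *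
        (-1) ^ ((k - 1) * (n - k))) = -1 := by
      rw [← pow_add, ← pow_add, ← pow_add]
      apply Odd.neg_one_pow
      obtain ⟨i, rfl⟩ := Nat.exists_eq_add_of_le' hk
      obtain ⟨m, rfl⟩ := Nat.exists_eq_add_of_le hkn
      simp only [Nat.add_sub_cancel, Nat.add_sub_cancel_left]
      -- With k = i + 1 and n = k + m the total exponent is a product of consecutive integers plus
      -- an even number plus one, hence odd.
      have : (i + 1) * (i + 1 + m) + (i + m + i * m) = (i * (i + 1)) + 2 * (i * m + m + i) + 1 := by
        ring
      rw [this]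
      refine Even.add_one (Even.add (Nat.even_mul_succ_self i) (even_two_mul _))
    rw [s1, s2, t2']
    linear_combination (sgn {j} β * A (basisVec j) (insert j β)) * par +
      (-1 : ℝ) ^ (k * n) * (-1) ^ (k - 1) * sgn {j} β * A (basisVec j) (insert j β) *
        (sgn β γ * sgn γ β * t1 + (-1) ^ (n - k) * t3)
  · rw [hA _ _ hβ]; simp

/-- Every index j ∈ γ contributes b γ once, which gives the factor k on degree k. -/
theorem extSymbol_contract {k : ℕ} {b : Cov n} (hb : b ∈ Hom n k) :
    extSymbol (LinearMap.toContinuousLinearMap (contract b)) = (k : ℝ) • b := by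
  ext γ
  rw [extSymbol_apply, PiLp.smul_apply, smul_eq_mul]
  have : ∀ j ∈ γ, sgn {j} (γ.erase j) *
      LinearMap.toContinuousLinearMap (contract b) (basisVec j) (γ.erase j) = b γ := by
    intro j hj
    rw [LinearMap.coe_toContinuousLinearMap', contract_apply,
      Finset.sum_eq_single_of_mem j (by simp)]
    · rw [Finset.insert_erase hj]
      simp only [PiLp.single_apply, if_true, mul_one]
      rw [← mul_assoc, sgn_mul_self, one_mul]
    · intro i _ hi
      simp [basisVec, hi]
  rw [Finset.sum_congr rfl this, Finset.sum_const, nsmul_eq_mul]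
  by_cases hγ : γ.card = k
  · rw [hγ]
  · rw [hb γ hγ]; simp

/-- The coefficient of v ⌟ b at `insert j β` involves only v i with i outside that set, so it does
not change in direction j. The vanishing of d on v ∧ b below is the dual fact. -/
theorem coSymbol_contract (b : Cov n) :
    coSymbol (LinearMap.toContinuousLinearMap (contract b)) = 0 := by
  ext β
  rw [coSymbol_apply, PiLp.zero_apply, neg_eq_zero]
  refine Finset.sum_eq_zero fun j _ => ?_
  rw [LinearMap.coe_toContinuousLinearMap', contract_apply, Finset.sum_eq_zero, mul_zero]
  intro i hi
  have : i ≠ j := by rintro rfl; simp at hi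
  simp [basisVec, this]

theorem extSymbol_wedge (b : Cov n) :
    extSymbol (LinearMap.toContinuousLinearMap (wedge b)) = 0 := by
  ext β
  rw [extSymbol_apply, PiLp.zero_apply]
  refine Finset.sum_eq_zero fun j _ => ?_
  rw [LinearMap.coe_toContinuousLinearMap', wedge_apply, Finset.sum_eq_zero, mul_zero]
  intro i hi
  have : i ≠ j := by rintro rfl; simp at hi
  simp [basisVec, this]

/-- Every index outside β contributes b β once, and there are n - p = q of them. -/
theorem coSymbol_wedge {p q : ℕ} (h : p + q = n) {b : Cov n} (hb : b ∈ Hom n p) :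
    coSymbol (LinearMap.toContinuousLinearMap (wedge b)) = -(q : ℝ) • b := by
  ext β
  rw [coSymbol_apply, PiLp.smul_apply, smul_eq_mul, neg_mul]
  congr 1
  have : ∀ j ∈ βᶜ, sgn {j} β *
      LinearMap.toContinuousLinearMap (wedge b) (basisVec j) (insert j β) = b β := by
    intro j hj
    rw [LinearMap.coe_toContinuousLinearMap', wedge_apply,
      Finset.sum_eq_single_of_mem j (by simp)]
    · rw [Finset.erase_insert (Finset.mem_compl.1 hj)]
      simp only [PiLp.single_apply, if_true, mul_one]
      rw [← mul_assoc, sgn_mul_self, one_mul]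
    · intro i _ hi
      simp [basisVec, hi]
  rw [Finset.sum_congr rfl this, Finset.sum_const, nsmul_eq_mul]
  by_cases hβ : β.card = p
  · rw [Finset.card_compl, hβ, Fintype.card_fin]
    congr 2
    omega
  · rw [hb β hβ]; simp

/-! ### Weak exterior derivatives -/

theorem isWeakD_of_contDiff (U : Set (Pt n)) {ω : Form n} (hω : ContDiff ℝ 1 ω) :
    IsWeakD U ω (fun x => extSymbol (fderiv ℝ ω x)) := by
  intro φ hφ hc hs γ
  have hφ0 : ∀ x, x ∉ U → φ x = 0 := fun x hx => image_eq_zero_of_notMem_tsupport fun h => hx (hs h)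
  have hφ1 : ∀ x, x ∉ U → fderiv ℝ φ x = 0 := fun x hx =>
    image_eq_zero_of_notMem_tsupport fun h => hx (hs (tsupport_fderiv_subset ℝ h))
  -- The test function vanishes off U, so integration by parts can be done on the whole space, with
  -- no regularity of U and no boundary terms.
  rw [setIntegral_eq_integral_of_forall_compl_eq_zero fun x hx => by rw [hφ0 x hx, zero_mul],
    setIntegral_eq_integral_of_forall_compl_eq_zero fun x hx =>
      Finset.sum_eq_zero fun j _ => by simp [hφ1 x hx]]
  have comp : ∀ β x v, fderiv ℝ (fun y => ω y β) x v = fderiv ℝ ω x v β := by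
    intro β x v
    have := ((EuclideanSpace.proj (𝕜 := ℝ) β).hasFDerivAt.comp x
      (hω.differentiable (by norm_num) x).hasFDerivAt).fderiv
    change fderiv ℝ (⇑(EuclideanSpace.proj β) ∘ ω) x v = _
    rw [this]
    rfl
  have hωβ : ∀ β, ContDiff ℝ 1 (fun y => ω y β) := fun β =>
    (EuclideanSpace.proj (𝕜 := ℝ) β).contDiff.comp hω
  have hφ' : ContDiff ℝ 1 φ := hφ.of_le (by exact_mod_cast le_top)
  have c1 : ∀ β v, Continuous fun x => fderiv ℝ ω x v β := fun β v => by
    simp_rw [← comp]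
    exact ((hωβ β).continuous_fderiv (by norm_num)).clm_apply continuous_const
  have c2 : ∀ v, Continuous fun x => fderiv ℝ φ x v := fun v =>
    (hφ'.continuous_fderiv (by norm_num)).clm_apply continuous_const
  have i1 : ∀ β v, Integrable fun x => φ x * fderiv ℝ ω x v β := fun β v =>
    (hφ.continuous.mul (c1 β v)).integrable_of_hasCompactSupport hc.mul_right
  have i2 : ∀ β v, Integrable fun x => fderiv ℝ φ x v * ω x β := fun β v =>
    ((c2 v).mul (hωβ β).continuous).integrable_of_hasCompactSupport
      (HasCompactSupport.mul_right (hc.fderiv_apply (𝕜 := ℝ) v))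
  have i3 : ∀ β, Integrable fun x => φ x * ω x β := fun β =>
    (hφ.continuous.mul (hωβ β).continuous).integrable_of_hasCompactSupport hc.mul_right
  simp only [extSymbol_apply, Finset.mul_sum]
  rw [integral_finsetSum, integral_finsetSum, ← Finset.sum_neg_distrib]
  · refine Finset.sum_congr rfl fun j _ => ?_
    have := integral_mul_fderiv_eq_neg_fderiv_mul_of_integrable (μ := (volume : Measure (Pt n)))
      (f := φ) (g := fun y => ω y (γ.erase j)) (v := basisVec j) (i2 _ _)
      (by simpa only [comp] using i1 _ _) (i3 _)
      (fun x _ => hφ'.differentiable (by norm_num) x)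
      (fun x _ => (hωβ _).differentiable (by norm_num) x)
    simp only [comp] at this
    rw [integral_const_mul, ← mul_neg, ← this, ← integral_const_mul]
    simp only [mul_left_comm]
  · intro j _
    exact (i2 _ _).const_mul _
  · intro j _
    refine ((i1 (γ.erase j) (basisVec j)).const_mul (sgn {j} (γ.erase j))).congr ?_
    filter_upwards with x
    ring

theorem IsWeakD.congr {U : Set (Pt n)} {ω η ω' η' : Form n} (h : IsWeakD U ω η)
    (hω : ω =ᵐ[volume.restrict U] ω') (hη : η =ᵐ[volume.restrict U] η') : IsWeakD U ω' η' := by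
  intro φ hφ hc hs γ
  rw [← integral_congr_ae (f := fun x => φ x * η x γ), h φ hφ hc hs γ]
  · congr 1
    refine integral_congr_ae ?_
    filter_upwards [hω] with x hx
    rw [hx]
  · filter_upwards [hη] with x hx
    rw [hx]

theorem IsWeakD.mono {U U' : Set (Pt n)} {ω η : Form n} (h : IsWeakD U ω η) (hU : U' ⊆ U) :
    IsWeakD U' ω η := by
  intro φ hφ hc hs γ
  have hφ0 : ∀ x, x ∉ U' → φ x = 0 :=
    fun x hx => image_eq_zero_of_notMem_tsupport fun h => hx (hs h)
  have hφ1 : ∀ x, x ∉ U' → fderiv ℝ φ x = 0 := fun x hx =>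
    image_eq_zero_of_notMem_tsupport fun h => hx (hs (tsupport_fderiv_subset ℝ h))
  have := h φ hφ hc (hs.trans hU) γ
  rw [setIntegral_eq_integral_of_forall_compl_eq_zero fun x hx => by
      rw [hφ0 x fun h => hx (hU h), zero_mul],
    setIntegral_eq_integral_of_forall_compl_eq_zero fun x hx =>
      Finset.sum_eq_zero fun j _ => by simp [hφ1 x fun h => hx (hU h)]] at this
  rwa [setIntegral_eq_integral_of_forall_compl_eq_zero fun x hx => by rw [hφ0 x hx, zero_mul],
    setIntegral_eq_integral_of_forall_compl_eq_zero fun x hx =>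
      Finset.sum_eq_zero fun j _ => by simp [hφ1 x hx]]

theorem integrable_mul_coord {Ω U : Set (Pt n)} (hU : U ⊆ Ω) (ω : L2 Ω) {φ : Pt n → ℝ}
    (hφ : Continuous φ) (hc : HasCompactSupport φ) (γ : Finset (Fin n)) :
    Integrable (fun x => φ x * ω x γ) (volume.restrict U) := by
  have h1 : MemLp (fun x => ω x) 2 (volume.restrict U) :=
    (Lp.memLp ω).mono_measure (Measure.restrict_mono_set _ hU)
  have h2 : LocallyIntegrable (fun x => ω x γ) (volume.restrict U) := by
    intro x
    obtain ⟨s, hs, hi⟩ := h1.locallyIntegrable (by norm_num) x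
    exact ⟨s, hs, (EuclideanSpace.proj (𝕜 := ℝ) γ).integrable_comp hi⟩
  exact h2.integrable_smul_left_of_hasCompactSupport hφ hc

theorem IsWeakD.add {Ω U : Set (Pt n)} (hU : U ⊆ Ω) {ω η ω' η' : L2 Ω}
    (h : IsWeakD U ω η) (h' : IsWeakD U ω' η') : IsWeakD U (ω + ω' : L2 Ω) (η + η' : L2 Ω) := by
  refine IsWeakD.congr (ω := fun x => ω x + ω' x) (η := fun x => η x + η' x) ?_
    (ae_restrict_of_ae_restrict_of_subset hU (Lp.coeFn_add ω ω').symm)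
    (ae_restrict_of_ae_restrict_of_subset hU (Lp.coeFn_add η η').symm)
  intro φ hφ hc hs γ
  have hφ' : ContDiff ℝ 1 φ := hφ.of_le (by exact_mod_cast le_top)
  have i : ∀ ω : L2 Ω, ∀ j, Integrable (fun x => sgn {j} (γ.erase j) *
      (fderiv ℝ φ x (EuclideanSpace.single j 1) * ω x (γ.erase j))) (volume.restrict U) :=
    fun ω j => (integrable_mul_coord hU ω
      ((hφ'.continuous_fderiv (by norm_num)).clm_apply continuous_const)
      (hc.fderiv_apply (𝕜 := ℝ) _) _).const_mul _
  simp only [PiLp.add_apply, mul_add, Finset.sum_add_distrib]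
  rw [integral_add (integrable_mul_coord hU η hφ.continuous hc γ)
    (integrable_mul_coord hU η' hφ.continuous hc γ),
    integral_add (integrable_finsetSum _ fun j _ => i ω j)
      (integrable_finsetSum _ fun j _ => i ω' j), h φ hφ hc hs γ, h' φ hφ hc hs γ, neg_add]

theorem IsWeakD.smul {Ω U : Set (Pt n)} (hU : U ⊆ Ω) {ω η : L2 Ω} (r : ℝ)
    (h : IsWeakD U ω η) : IsWeakD U (r • ω : L2 Ω) (r • η : L2 Ω) := by
  refine IsWeakD.congr (ω := fun x => r • ω x) (η := fun x => r • η x) ?_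
    (ae_restrict_of_ae_restrict_of_subset hU (Lp.coeFn_smul r ω).symm)
    (ae_restrict_of_ae_restrict_of_subset hU (Lp.coeFn_smul r η).symm)
  intro φ hφ hc hs γ
  simp only [PiLp.smul_apply, smul_eq_mul, mul_left_comm _ r, ← Finset.mul_sum]
  rw [integral_const_mul, integral_const_mul, h φ hφ hc hs γ, mul_neg]

/-! ### The cells of a simplicial subdivision -/

namespace SimplicialSubdivision

variable {Ω : Set (Pt n)} (G : SimplicialSubdivision Ω)

theorem finite_cells : G.cells.Finite := by
  refine (Set.Finite.image (fun s : Finset (Pt n) => interior (convexHull ℝ (s : Set (Pt n))))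
    G.finite_faces).subset ?_
  rintro T ⟨s, hs, -, rfl⟩
  exact ⟨s, hs, rfl⟩

instance : Finite G.cells := G.finite_cells.to_subtype

variable {G} {T T' : Set (Pt n)}

theorem isOpen_of_mem_cells (hT : T ∈ G.cells) : IsOpen T := by
  obtain ⟨s, -, -, rfl⟩ := hT
  exact isOpen_interior

theorem subset_of_mem_cells (hT : T ∈ G.cells) : T ⊆ Ω := by
  obtain ⟨s, hs, -, rfl⟩ := hT
  exact G.interior_subset s hs

theorem isBounded_of_mem_cells (hT : T ∈ G.cells) : Bornology.IsBounded T := by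
  obtain ⟨s, hs, -, rfl⟩ := hT
  exact ((isBounded_convexHull.2 s.finite_toSet.isBounded)).subset _root_.interior_subset

theorem nonempty_of_mem_cells (hT : T ∈ G.cells) : T.Nonempty := by
  obtain ⟨s, hs, hc, rfl⟩ := hT
  rw [interior_convexHull_nonempty_iff_affineSpan_eq_top]
  have := (G.indep hs).affineSpan_eq_top_iff_card_eq_finrank_add_one
  simp only [Subtype.range_coe_subtype, Finset.setOfPred_mem] at this
  rw [this]
  simp [hc]

/-- Two distinct simplices of the complex meet in the hull of their common vertices. These are at
most n points, so the hull has empty interior. -/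
theorem eq_of_not_disjoint_cells (hT : T ∈ G.cells) (hT' : T' ∈ G.cells)
    (h : ¬ Disjoint T T') : T = T' := by
  classical
  obtain ⟨s, hs, hc, rfl⟩ := hT
  obtain ⟨t, ht, hc', rfl⟩ := hT'
  by_cases hst : s = t
  · rw [hst]
  exfalso
  rw [Set.not_disjoint_iff_nonempty_inter, ← interior_inter, G.convexHull_inter_convexHull hs ht,
    interior_convexHull_nonempty_iff_affineSpan_eq_top, ← Finset.coe_inter] at h
  have hle : (s ∩ t).card ≤ n := by
    by_contra hlt
    have h1 : s ∩ t = s := Finset.eq_of_subset_of_card_le Finset.inter_subset_left (by omega)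
    have h2 : s ∩ t = t := Finset.eq_of_subset_of_card_le Finset.inter_subset_right (by omega)
    exact hst (h1.symm.trans h2)
  have hi : AffineIndependent ℝ ((↑) : (s ∩ t : Finset (Pt n)) → Pt n) :=
    (G.indep hs).mono (Finset.coe_subset.2 Finset.inter_subset_left)
  have := hi.affineSpan_eq_top_iff_card_eq_finrank_add_one
  simp only [Subtype.range_coe_subtype, Finset.setOfPred_mem] at this
  rw [this] at h
  simp at h
  omega

/-- By purity each point of Ω is in a closed n-simplex, so a point in no cell lies on the frontier
of one of finitely many convex sets, and such frontiers are null. -/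
theorem volume_diff_cells : volume (Ω \ ⋃₀ G.cells) = 0 := by
  have hsub : Ω \ ⋃₀ G.cells ⊆ ⋃ s ∈ G.faces, frontier (convexHull ℝ (s : Set (Pt n))) := by
    rintro x ⟨hx, hxc⟩
    have hx' : x ∈ G.toSimplicialComplex.space := G.space_eq ▸ subset_closure hx
    obtain ⟨s, hs, hxs⟩ := Geometry.SimplicialComplex.mem_space_iff.1 hx'
    obtain ⟨t, ht, hst, hc⟩ := G.pure s hs
    refine Set.mem_biUnion ht ⟨subset_closure (convexHull_mono (by exact_mod_cast hst) hxs), ?_⟩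
    exact fun hi => hxc ⟨_, ⟨t, ht, hc, rfl⟩, hi⟩
  refine measure_mono_null hsub ((measure_biUnion_null_iff G.finite_faces.countable).2 ?_)
  intro s _
  exact (convex_convexHull ℝ _).addHaar_frontier _

theorem volume_pos (hT : T ∈ G.cells) : 0 < volume.real T :=
  ENNReal.toReal_pos ((isOpen_of_mem_cells hT).measure_pos _ (nonempty_of_mem_cells hT)).ne'
    (isBounded_of_mem_cells hT).measure_lt_top.ne

theorem integrableOn_of_continuous {E : Type*} [NormedAddCommGroup E] (hT : T ∈ G.cells)
    {f : Pt n → E} (hf : Continuous f) : IntegrableOn f T :=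
  (hf.continuousOn.integrableOn_compact
    (isBounded_of_mem_cells hT).isCompact_closure).mono_set subset_closure

theorem integral_sub_centre (hT : T ∈ G.cells) : ∫ x in T, (x - centre T) = 0 := by
  have hi : IntegrableOn (fun x : Pt n => x - centre T) T :=
    integrableOn_of_continuous hT (by fun_prop)
  ext j
  have e := (EuclideanSpace.proj (𝕜 := ℝ) j).integral_comp_comm hi
  simp only [PiLp.proj_apply, PiLp.sub_apply] at e
  rw [← e, integral_sub (integrableOn_of_continuous hT (by fun_prop)) (by
    exact integrableOn_of_continuous hT (by fun_prop)), setIntegral_const, PiLp.zero_apply,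
    sub_eq_zero]
  change _ = volume.real T • ⨍ x in T, x j
  rw [setAverage_eq, smul_smul, mul_inv_cancel₀ (volume_pos hT).ne', one_smul]

theorem integral_clm_sub_centre (hT : T ∈ G.cells) {E : Type*} [NormedAddCommGroup E]
    [NormedSpace ℝ E] [CompleteSpace E] (A : Pt n →L[ℝ] E) :
    ∫ x in T, A (x - centre T) = 0 := by
  rw [A.integral_comp_comm (integrableOn_of_continuous hT (by fun_prop)), integral_sub_centre hT,
    map_zero]

/-! ### Gluing continuous forms over the cells -/

theorem memLp_indicator (hT : T ∈ G.cells) {ω : Form n} (hω : Continuous ω) :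
    MemLp (T.indicator ω) 2 (volume.restrict Ω) := by
  rw [memLp_indicator_iff_restrict (isOpen_of_mem_cells hT).measurableSet]
  have hb := isBounded_of_mem_cells hT
  obtain ⟨C, hC⟩ := hb.isCompact_closure.exists_bound_of_continuousOn hω.continuousOn
  have : IsFiniteMeasure ((volume.restrict Ω).restrict T) :=
    ⟨by
      rw [Measure.restrict_apply_univ]
      exact (Measure.restrict_apply_le _ _).trans_lt hb.measure_lt_top⟩
  refine MemLp.of_bound hω.aestronglyMeasurable C ?_
  filter_upwards [ae_restrict_mem (isOpen_of_mem_cells hT).measurableSet] with x hx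
  exact hC x (subset_closure hx)

variable (G) in
/-- The continuous form `ω` on the cell `T`, extended by zero. -/
def piece (T : G.cells) : C(Pt n, Cov n) →ₗ[ℝ] L2 Ω where
  toFun ω := (memLp_indicator T.2 ω.continuous).toLp _
  map_add' ω η := by
    rw [← MemLp.toLp_add]
    congr 1
    exact Set.indicator_add _ _ _
  map_smul' r ω := by
    rw [RingHom.id_apply, ← MemLp.toLp_const_smul]
    congr 1
    exact Set.indicator_const_smul _ r (ω : Pt n → Cov n)

theorem restrict_cell (hT : T ∈ G.cells) {P : Pt n → Prop}
    (h : ∀ᵐ x ∂(volume.restrict Ω), P x) : ∀ᵐ x ∂(volume.restrict T), P x :=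
  ae_restrict_of_ae_restrict_of_subset (subset_of_mem_cells hT) h

theorem piece_ae (T : G.cells) (ω : C(Pt n, Cov n)) :
    G.piece T ω =ᵐ[volume.restrict Ω] (T : Set (Pt n)).indicator ω :=
  MemLp.coeFn_toLp (memLp_indicator T.2 ω.continuous)

theorem ae_exists_cell (G : SimplicialSubdivision Ω) :
    ∀ᵐ x ∂(volume.restrict Ω), ∃ T : G.cells, x ∈ (T : Set (Pt n)) := by
  have ho : IsOpen (⋃₀ G.cells) := isOpen_sUnion fun _ => isOpen_of_mem_cells
  have h : ∀ᵐ x ∂(volume.restrict Ω), x ∈ ⋃₀ G.cells := by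
    rw [ae_iff]
    refine le_antisymm (le_trans (le_of_eq ?_) (volume_diff_cells (G := G)).le) zero_le
    change volume.restrict Ω (⋃₀ G.cells)ᶜ = _
    rw [Measure.restrict_apply ho.measurableSet.compl, Set.sdiff_eq, Set.inter_comm]
  filter_upwards [h] with x ⟨T, hT, hx⟩
  exact ⟨⟨T, hT⟩, hx⟩

theorem ae_of_forall_cell {P : Pt n → Prop}
    (h : ∀ T : G.cells, ∀ᵐ x ∂(volume.restrict (T : Set (Pt n))), P x) :
    ∀ᵐ x ∂(volume.restrict Ω), P x := by
  have h' : ∀ T : G.cells, ∀ᵐ x, x ∈ (T : Set (Pt n)) → P x := fun T =>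
    (ae_restrict_iff' (isOpen_of_mem_cells T.2).measurableSet).1 (h T)
  filter_upwards [ae_restrict_of_ae (ae_all_iff.2 h'), G.ae_exists_cell] with x hx ⟨T, hT⟩
  exact hx T hT

theorem coeFn_sum {ι : Type*} (s : Finset ι) (f : ι → L2 Ω) :
    ⇑(∑ i ∈ s, f i) =ᵐ[volume.restrict Ω] ∑ i ∈ s, ⇑(f i) := by
  classical
  induction s using Finset.induction_on with
  | empty => simpa using Lp.coeFn_zero (Cov n) 2 (volume.restrict Ω)
  | insert i s hi ih =>
    rw [Finset.sum_insert hi, Finset.sum_insert hi]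
    filter_upwards [Lp.coeFn_add (f i) (∑ i ∈ s, f i), ih] with x h1 h2
    rw [h1, Pi.add_apply, Pi.add_apply, h2]

variable (G) in
/-- The form that agrees with `p T` on the cell `T`. -/
def glue (p : G.cells → C(Pt n, Cov n)) : L2 Ω := ∑ᶠ T, G.piece T (p T)

theorem glue_ae (p : G.cells → C(Pt n, Cov n)) (T : G.cells) :
    G.glue p =ᵐ[volume.restrict (T : Set (Pt n))] p T := by
  classical
  have := Fintype.ofFinite G.cells
  rw [glue, finsum_eq_sum_of_fintype]
  have h1 := restrict_cell T.2 (coeFn_sum Finset.univ fun T => G.piece T (p T))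
  have h2 : ∀ᵐ x ∂(volume.restrict (T : Set (Pt n))), ∀ T' : G.cells,
      G.piece T' (p T') x = (T' : Set (Pt n)).indicator (p T') x :=
    ae_all_iff.2 fun T' => restrict_cell T.2 (piece_ae T' (p T'))
  filter_upwards [h1, h2, ae_restrict_mem (isOpen_of_mem_cells T.2).measurableSet] with x hx hx' hT
  rw [hx, Finset.sum_apply, Finset.sum_eq_single_of_mem T (Finset.mem_univ _), hx',
    Set.indicator_of_mem hT]
  intro T' _ hne
  rw [hx', Set.indicator_of_notMem]
  intro hT'
  exact hne (Subtype.ext (eq_of_not_disjoint_cells T'.2 T.2 (Set.not_disjoint_iff.2 ⟨x, hT', hT⟩)))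

theorem eq_glue {ω : L2 Ω} {p : G.cells → C(Pt n, Cov n)}
    (h : ∀ T : G.cells, ω =ᵐ[volume.restrict (T : Set (Pt n))] p T) : ω = G.glue p := by
  refine Lp.ext (ae_of_forall_cell (G := G) fun T => ?_)
  filter_upwards [h T, glue_ae p T] with x h1 h2
  rw [h1, h2]

theorem inner_glue (η : L2 Ω) (q p : G.cells → C(Pt n, Cov n)) (h : η = G.glue q) :
    inner ℝ η (G.glue p) = ∑ᶠ T : G.cells, ∫ x in (T : Set (Pt n)), inner ℝ (q T x) (p T x) := by
  classical
  have := Fintype.ofFinite G.cells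
  rw [glue, finsum_eq_sum_of_fintype, finsum_eq_sum_of_fintype, inner_sum]
  refine Finset.sum_congr rfl fun T _ => ?_
  rw [L2.inner_def]
  have hm := (isOpen_of_mem_cells T.2).measurableSet
  have h1 : (fun x => inner ℝ (η x) (G.piece T (p T) x)) =ᵐ[volume.restrict Ω]
      (T : Set (Pt n)).indicator fun x => inner ℝ (η x) (p T x) := by
    filter_upwards [piece_ae T (p T)] with x hx
    rw [hx]
    by_cases hxT : x ∈ (T : Set (Pt n)) <;> simp [hxT]
  rw [integral_congr_ae h1, integral_indicator hm, Measure.restrict_restrict hm,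
    Set.inter_eq_left.2 (subset_of_mem_cells T.2)]
  refine integral_congr_ae ?_
  filter_upwards [glue_ae q T] with x hx
  rw [h, hx]

end SimplicialSubdivision

/-! ### Local spaces in coordinates -/

theorem single_mem_Hom {k : ℕ} {α : Finset (Fin n)} (hα : α.card = k) : dx α ∈ Hom n k := by
  intro β hβ
  have : β ≠ α := by rintro rfl; exact hβ hα
  simp [dx, this]

theorem sum_smul_dx (a : Cov n) : ∑ α, a α • dx α = a := by
  ext β
  simp [dx, Pi.single_apply]

theorem mem_P0 {k : ℕ} {ω : Form n} : ω ∈ P0 n k ↔ ∃ a ∈ Hom n k, ω = fun _ => a := by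
  constructor
  · intro h
    refine Submodule.span_induction ?_ ?_ ?_ ?_ h
    · rintro _ ⟨α, hα, rfl⟩
      exact ⟨dx α, single_mem_Hom hα, rfl⟩
    · exact ⟨0, zero_mem _, rfl⟩
    · rintro _ _ _ _ ⟨a, ha, rfl⟩ ⟨b, hb, rfl⟩
      exact ⟨a + b, add_mem ha hb, rfl⟩
    · rintro r _ _ ⟨a, ha, rfl⟩
      exact ⟨r • a, Submodule.smul_mem _ _ ha, rfl⟩
  · rintro ⟨a, ha, rfl⟩
    have : (fun _ : Pt n => a) = ∑ α : Finset (Fin n), a α • fun _ : Pt n => dx α := by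
      ext1 x
      rw [Finset.sum_apply]
      exact (sum_smul_dx a).symm
    rw [this]
    refine sum_mem fun α _ => ?_
    by_cases hα : α.card = k
    · exact Submodule.smul_mem _ _ (Submodule.subset_span ⟨α, hα, rfl⟩)
    · rw [ha α hα, zero_smul]
      exact zero_mem _

theorem mem_map_koszul {k : ℕ} (c : Pt n) {ω : Form n} :
    ω ∈ (P0 n k).map (koszul c) ↔ ∃ b ∈ Hom n k, ω = fun x => contract b (x - c) := by
  constructor
  · rintro ⟨_, h, rfl⟩
    obtain ⟨b, hb, rfl⟩ := mem_P0.1 h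
    exact ⟨b, hb, rfl⟩
  · rintro ⟨b, hb, rfl⟩
    exact ⟨fun _ => b, mem_P0.2 ⟨b, hb, rfl⟩, rfl⟩

/-- Moving the base point changes the Koszul part by the constant form c ⌟ b, so the space does not
depend on it; each cell may use its own centre. -/
theorem mem_PMinus {k : ℕ} (c : Pt n) {ω : Form n} :
    ω ∈ PMinus n k ↔
      ∃ a ∈ Hom n k, ∃ b ∈ Hom n (k + 1), ω = fun x => a + contract b (x - c) := by
  rw [PMinus, Submodule.mem_sup]
  constructor
  · rintro ⟨_, h, _, h', rfl⟩
    obtain ⟨a, ha, rfl⟩ := mem_P0.1 h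
    obtain ⟨b, hb, rfl⟩ := (mem_map_koszul 0).1 h'
    refine ⟨a + contract b c, add_mem ha (contract_mem hb c), b, hb, ?_⟩
    ext1 x
    simp only [Pi.add_apply, map_sub, map_zero]
    abel
  · rintro ⟨a, ha, b, hb, rfl⟩
    refine ⟨_, mem_P0.2 ⟨a - contract b c, sub_mem ha (contract_mem hb c), rfl⟩, _,
      (mem_map_koszul 0).2 ⟨b, hb, rfl⟩, ?_⟩
    ext1 x
    simp only [Pi.add_apply, map_sub, map_zero]
    abel

theorem wedge_add_mem_PStarMinus {k : ℕ} (hk : k + 1 ≤ n) (c : Pt n) {u v : Cov n}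
    (hu : u ∈ Hom n k) (hv : v ∈ Hom n (k + 1)) :
    (fun x => wedge u (x - c) + v) ∈ PStarMinus n (k + 1) := by
  obtain ⟨q, rfl⟩ := Nat.exists_eq_add_of_le hk
  have e : k + 1 + q - (k + 1) = q := by omega
  rw [PStarMinus, e]
  -- The signs invert the star: the first is that of ⋆⋆ on v, the second that of ⋆κ⋆ on u.
  refine ⟨fun x => (-1 : ℝ) ^ (q * (k + 1)) • hodge _ v +
    contract ((-1 : ℝ) ^ (k * q) • hodge _ u) (x - c), (mem_PMinus c).2
      ⟨_, Submodule.smul_mem _ _ (hodge_mem (by omega) hv), _,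
        Submodule.smul_mem _ _ (hodge_mem (by omega) hu), rfl⟩, ?_⟩
  ext1 x
  change hodge _ ((-1 : ℝ) ^ (q * (k + 1)) • hodge _ v +
    contract ((-1 : ℝ) ^ (k * q) • hodge _ u) (x - c)) = _
  rw [map_add, map_smul, hodge_hodge (m := q) (by omega) hv, map_smul, LinearMap.smul_apply,
    map_smul, hodge_contract_hodge (q := q) (by omega) hu, smul_smul, smul_smul, mul_comm q,
    ← mul_pow, ← mul_pow]
  norm_num
  exact add_comm _ _

/-- The form `∑_α h_α μ_{δ,T}^α`. -/
def muForm (T : Set (Pt n)) (h : Cov n) : Form n := fun x => WithLp.toLp 2 fun α =>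
  (∑ j ∈ α, ((x j - centre T j) ^ 2 - ⨍ y in T, (y j - centre T j) ^ 2)) * h α

theorem exists_of_mem_HDelta {k : ℕ} {T : Set (Pt n)} {ω : Form n} (hω : ω ∈ HDelta k T) :
    ∃ h ∈ Hom n k, ω = muForm T h := by
  refine Submodule.span_induction ?_ ?_ ?_ ?_ hω
  · rintro _ ⟨α, hα, rfl⟩
    refine ⟨dx α, single_mem_Hom hα, ?_⟩
    ext x β
    by_cases hβ : β = α
    · subst hβ; simp [muForm, muDelta, dx]
    · simp [muForm, muDelta, dx, hβ]
  · refine ⟨0, zero_mem _, ?_⟩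
    ext x β
    simp [muForm]
  · rintro _ _ _ _ ⟨a, ha, rfl⟩ ⟨b, hb, rfl⟩
    refine ⟨a + b, add_mem ha hb, ?_⟩
    ext x β
    simp [muForm, mul_add]
  · rintro r _ _ ⟨a, ha, rfl⟩
    refine ⟨r • a, Submodule.smul_mem _ _ ha, ?_⟩
    ext x β
    simp [muForm, mul_left_comm]

/-- The general element of `P^{m+δ}_{d∩δ}Λᵏ(T)`. -/
def shapeForm (T : Set (Pt n)) (a b c h : Cov n) : Form n := fun x =>
  a + contract b (x - centre T) + wedge c (x - centre T) + muForm T h x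

theorem exists_of_mem_PmDelta {k : ℕ} (hk : 1 ≤ k) (hkn : k ≤ n) {T : Set (Pt n)} {ω : Form n}
    (hω : ω ∈ PmDelta k T) :
    ∃ a ∈ Hom n k, ∃ b ∈ Hom n (k + 1), ∃ c ∈ Hom n (k - 1), ∃ h ∈ Hom n k,
      ω = shapeForm T a b c h := by
  rw [PmDelta] at hω
  obtain ⟨_, hω', _, h4, rfl⟩ := Submodule.mem_sup.1 hω
  obtain ⟨_, hω'', _, h3, rfl⟩ := Submodule.mem_sup.1 hω'
  obtain ⟨_, h1, _, h2, rfl⟩ := Submodule.mem_sup.1 hω''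
  obtain ⟨a, ha, rfl⟩ := mem_P0.1 h1
  obtain ⟨b, hb, rfl⟩ := (mem_map_koszul _).1 h2
  obtain ⟨_, h3, rfl⟩ := h3
  obtain ⟨c, hc, rfl⟩ := mem_P0.1 h3
  obtain ⟨h, hh, rfl⟩ := exists_of_mem_HDelta h4
  -- The sign of `hodge_contract_hodge` with p = k - 1 and q = n - k is absorbed into the wedge
  -- coefficient.
  refine ⟨a, ha, b, hb, (-1 : ℝ) ^ ((k - 1) * (n - k)) • c, Submodule.smul_mem _ _ hc, h, hh, ?_⟩
  ext1 x
  simp only [Pi.add_apply, shapeForm, map_smul, LinearMap.smul_apply]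
  rw [← hodge_contract_hodge (by omega) hc]
  rfl

theorem const_mem_PmDelta {k : ℕ} {T : Set (Pt n)} {a : Cov n} (ha : a ∈ Hom n k) :
    (fun _ => a) ∈ PmDelta k T :=
  Submodule.mem_sup_left (Submodule.mem_sup_left (Submodule.mem_sup_left (mem_P0.2 ⟨a, ha, rfl⟩)))

/-! ### Derivatives of shape functions -/

theorem fderiv_coord {ω : Form n} {x : Pt n} (hω : DifferentiableAt ℝ ω x) (v : Pt n)
    (β : Finset (Fin n)) : fderiv ℝ ω x v β = fderiv ℝ (fun y => ω y β) x v := by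
  have := ((EuclideanSpace.proj (𝕜 := ℝ) β).hasFDerivAt.comp x hω.hasFDerivAt).fderiv
  change _ = fderiv ℝ (⇑(EuclideanSpace.proj β) ∘ ω) x v
  rw [this]
  rfl

theorem fderiv_mem_Hom {k : ℕ} {ω : Form n} (hω : Differentiable ℝ ω) (h : ∀ x, ω x ∈ Hom n k)
    (x v : Pt n) : fderiv ℝ ω x v ∈ Hom n k := by
  intro β hβ
  have : (fun y => ω y β) = fun _ => 0 := funext fun y => h y β hβ
  rw [fderiv_coord (hω x), this]
  simp

theorem hasFDerivAt_linear_sub (A : Pt n →ₗ[ℝ] Cov n) (c x : Pt n) :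
    HasFDerivAt (fun y => A (y - c)) (LinearMap.toContinuousLinearMap A) x :=
  (LinearMap.toContinuousLinearMap A).hasFDerivAt.comp x ((hasFDerivAt_id x).sub_const c)

theorem contDiff_linear_sub (A : Pt n →ₗ[ℝ] Cov n) (c : Pt n) :
    ContDiff ℝ 1 fun y => A (y - c) :=
  (LinearMap.toContinuousLinearMap A).contDiff.comp (contDiff_id.sub contDiff_const)

theorem contDiff_muForm (T : Set (Pt n)) (h : Cov n) : ContDiff ℝ 1 (muForm T h) := by
  rw [contDiff_euclidean]
  intro α
  refine ContDiff.mul (ContDiff.sum fun j _ => ContDiff.sub (ContDiff.pow (ContDiff.sub ?_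
    contDiff_const) 2) contDiff_const) contDiff_const
  exact (EuclideanSpace.proj (𝕜 := ℝ) j).contDiff

theorem fderiv_muForm (T : Set (Pt n)) (h : Cov n) (x v : Pt n) (α : Finset (Fin n)) :
    fderiv ℝ (muForm T h) x v α = (∑ j ∈ α, 2 * (x j - centre T j) * v j) * h α := by
  rw [fderiv_coord ((contDiff_muForm T h).differentiable (by norm_num) x)]
  have hj : ∀ j ∈ α, HasFDerivAt
      (fun y : Pt n => (y j - centre T j) ^ 2 - ⨍ y in T, (y j - centre T j) ^ 2) _ x :=
    fun j _ => (((EuclideanSpace.proj (𝕜 := ℝ) j).hasFDerivAt (x := x)).sub_const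
      (centre T j)).pow 2 |>.sub_const _
  have := ((HasFDerivAt.fun_sum hj).mul_const (h α)).fderiv
  change fderiv ℝ (fun y : Pt n => (∑ j ∈ α, ((y j - centre T j) ^ 2 -
    ⨍ y in T, (y j - centre T j) ^ 2)) * h α) x v = _
  rw [this]
  simp [mul_comm]

/-- The coefficient at α depends only on coordinates with index in α, whereas d differentiates it
only in directions outside α. -/
theorem extSymbol_fderiv_muForm (T : Set (Pt n)) (h : Cov n) (x : Pt n) :
    extSymbol (fderiv ℝ (muForm T h) x) = 0 := by
  ext γ
  rw [extSymbol_apply, PiLp.zero_apply]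
  refine Finset.sum_eq_zero fun j _ => ?_
  rw [fderiv_muForm, Finset.sum_eq_zero, zero_mul, mul_zero]
  intro i hi
  have : i ≠ j := by rintro rfl; simp at hi
  simp [basisVec, this]

theorem coSymbol_fderiv_muForm (T : Set (Pt n)) (h : Cov n) (x : Pt n) :
    coSymbol (fderiv ℝ (muForm T h) x) = (-2 : ℝ) • contract h (x - centre T) := by
  ext β
  rw [coSymbol_apply, PiLp.smul_apply, contract_apply, smul_eq_mul, Finset.mul_sum,
    ← Finset.sum_neg_distrib]
  refine Finset.sum_congr rfl fun j _ => ?_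
  rw [fderiv_muForm, Finset.sum_eq_single_of_mem j (by simp)]
  · simp only [PiLp.single_apply, if_true, mul_one, PiLp.sub_apply]
    ring
  · intro i _ hi
    simp [basisVec, hi]

theorem contDiff_shapeForm (T : Set (Pt n)) (a b c h : Cov n) :
    ContDiff ℝ 1 (shapeForm T a b c h) :=
  ((contDiff_const.add (contDiff_linear_sub _ _)).add (contDiff_linear_sub _ _)).add
    (contDiff_muForm T h)

theorem shapeForm_mem_Hom {k : ℕ} (hk : 1 ≤ k) (T : Set (Pt n)) {a b c h : Cov n}
    (ha : a ∈ Hom n k) (hb : b ∈ Hom n (k + 1)) (hc : c ∈ Hom n (k - 1)) (hh : h ∈ Hom n k)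
    (x : Pt n) : shapeForm T a b c h x ∈ Hom n k := by
  have hw := wedge_mem hc (x - centre T)
  rw [Nat.sub_add_cancel hk] at hw
  refine add_mem (add_mem (add_mem ha (contract_mem hb _)) hw) fun α hα => ?_
  simp [muForm, hh α hα]

theorem fderiv_shapeForm (T : Set (Pt n)) (a b c h : Cov n) (x : Pt n) :
    fderiv ℝ (shapeForm T a b c h) x = LinearMap.toContinuousLinearMap (contract b) +
      LinearMap.toContinuousLinearMap (wedge c) + fderiv ℝ (muForm T h) x :=
  ((((hasFDerivAt_linear_sub (contract b) (centre T) x).const_add a).add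
    (hasFDerivAt_linear_sub (wedge c) (centre T) x)).add
    ((contDiff_muForm T h).differentiable (by norm_num) x).hasFDerivAt).fderiv

theorem extSymbol_fderiv_shapeForm {k : ℕ} (T : Set (Pt n)) (a c h : Cov n) {b : Cov n}
    (hb : b ∈ Hom n (k + 1)) (x : Pt n) :
    extSymbol (fderiv ℝ (shapeForm T a b c h) x) = ((k : ℝ) + 1) • b := by
  rw [fderiv_shapeForm, map_add, map_add, extSymbol_contract hb, extSymbol_wedge,
    extSymbol_fderiv_muForm]
  simp

theorem coSymbol_fderiv_shapeForm {k q : ℕ} (hq : k + q = n) (T : Set (Pt n)) (a b h : Cov n)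
    {c : Cov n} (hc : c ∈ Hom n k) (x : Pt n) :
    coSymbol (fderiv ℝ (shapeForm T a b c h) x) =
      (-(q : ℝ)) • c + (-2 : ℝ) • contract h (x - centre T) := by
  rw [fderiv_shapeForm, map_add, map_add, coSymbol_contract, coSymbol_wedge hq hc,
    coSymbol_fderiv_muForm, zero_add]

theorem muForm_zero (T : Set (Pt n)) : muForm T (0 : Cov n) = 0 := by
  ext x β
  simp [muForm]

namespace SimplicialSubdivision

variable {Ω : Set (Pt n)} {G : SimplicialSubdivision Ω}

/-! ### Piecewise derivatives of piecewise smooth forms -/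

theorem eq_dh {ω η : L2 Ω} (h : ∀ U ∈ G.cells, IsWeakD U ω η) : G.dh ω = η :=
  weakD_eq G.finite_cells.countable (fun _ => isOpen_of_mem_cells)
    (fun _ => subset_of_mem_cells) volume_diff_cells h

theorem extD_eq (hΩ : IsOpen Ω) {ω η : L2 Ω} (h : IsWeakD Ω ω η) : extD ω = η :=
  weakD_eq (Set.countable_singleton Ω) (by simpa using hΩ) (by simp) (by simp) (by simpa using h)

/-- A weak derivative on Ω is one on every cell, and both are unique. Existence is essential:
without it `extD` takes its default value 0. -/
theorem extD_eq_dh (hΩ : IsOpen Ω) {ω : L2 Ω} (h : ∃ η : L2 Ω, IsWeakD Ω ω η) :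
    extD ω = G.dh ω := by
  obtain ⟨η, h⟩ := h
  rw [extD_eq hΩ h, eq_dh (G := G) fun U hU => h.mono (subset_of_mem_cells hU)]

theorem dh_eq_glue {ω : L2 Ω} {p : G.cells → Form n} (q : G.cells → C(Pt n, Cov n))
    (hω : ∀ T : G.cells, ω =ᵐ[volume.restrict (T : Set (Pt n))] p T)
    (hp : ∀ T, ContDiff ℝ 1 (p T)) (hq : ∀ T x, extSymbol (fderiv ℝ (p T) x) = q T x) :
    G.dh ω = G.glue q := by
  refine eq_dh fun U hU => ?_
  refine (isWeakD_of_contDiff U (hp ⟨U, hU⟩)).congr (hω ⟨U, hU⟩).symm ?_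
  filter_upwards [glue_ae q ⟨U, hU⟩] with x hx
  rw [hx, hq]

theorem deltah_eq_glue {k : ℕ} (hk : 1 ≤ k) (hkn : k ≤ n) {ω : L2 Ω} {p : G.cells → Form n}
    (q : G.cells → C(Pt n, Cov n))
    (hω : ∀ T : G.cells, ω =ᵐ[volume.restrict (T : Set (Pt n))] p T)
    (hp : ∀ T, ContDiff ℝ 1 (p T)) (hpk : ∀ T x, p T x ∈ Hom n k)
    (hq : ∀ T x, coSymbol (fderiv ℝ (p T) x) = q T x) :
    G.deltah k ω = G.glue q := by
  have hd : ∀ T x, fderiv ℝ (fun y => hodge n (p T y)) x = (hodge n).comp (fderiv ℝ (p T) x) :=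
    fun T x => ((hodge n).hasFDerivAt.comp x
      ((hp T).differentiable (by norm_num) x).hasFDerivAt).fderiv
  have hc : ∀ T, ContDiff ℝ 1 fun y => hodge n (p T y) := fun T => (hodge n).contDiff.comp (hp T)
  let r : G.cells → C(Pt n, Cov n) := fun T =>
    ⟨fun x => extSymbol (fderiv ℝ (fun y => hodge n (p T y)) x),
      extSymbol.continuous_of_finiteDimensional.comp ((hc T).continuous_fderiv (by norm_num))⟩
  have e : G.dh (starL2 ω) = G.glue r := by
    refine dh_eq_glue r (p := fun T y => hodge n (p T y)) (fun T => ?_) hc fun _ _ => rfl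
    filter_upwards [restrict_cell T.2 ((hodge n).coeFn_compLp ω), hω T] with x h1 h2
    rw [starL2, h1, h2]
  refine eq_glue fun T => ?_
  rw [deltah, e]
  filter_upwards [restrict_cell T.2 (Lp.coeFn_smul ((-1 : ℝ) ^ (k * n)) (starL2 (G.glue r))),
    restrict_cell T.2 ((hodge n).coeFn_compLp (G.glue r)), glue_ae r T] with x h1 h2 h3
  rw [h1, Pi.smul_apply, starL2, h2, h3, ← hq]
  change _ • hodge n (extSymbol (fderiv ℝ (fun y => hodge n (p T y)) x)) = _
  rw [hd, hodge_extSymbol_hodge hk hkn _ fun v =>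
    fderiv_mem_Hom ((hp T).differentiable (by norm_num)) (hpk T) x v]

/-- Continuity upgrades almost everywhere to everywhere on the open cell, so equations in L² can be
evaluated at points. -/
theorem eqOn_zero_of_glue_eq_zero {q : G.cells → C(Pt n, Cov n)} (h : G.glue q = 0)
    (T : G.cells) {x : Pt n} (hx : x ∈ (T : Set (Pt n))) : q T x = 0 := by
  have h1 : q T =ᵐ[volume.restrict (T : Set (Pt n))] fun _ => 0 := by
    filter_upwards [glue_ae q T, restrict_cell T.2 (Lp.coeFn_zero (Cov n) 2 (volume.restrict Ω))]
      with x h1 h2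
    rw [← h1, h, h2, Pi.zero_apply]
  exact Measure.eqOn_open_of_ae_eq h1 (isOpen_of_mem_cells T.2) (q T).continuous.continuousOn
    continuousOn_const hx

/-! ### Spaces of discrete forms -/

/-- The form `x ↦ a + (x - c) ⌟ b`. -/
def contractForm (c : Pt n) : Cov n × Cov n →ₗ[ℝ] C(Pt n, Cov n) where
  toFun p := ⟨fun x => p.1 + contract p.2 (x - c),
    (contDiff_const.add (contDiff_linear_sub (contract p.2) c)).continuous⟩
  map_add' p q := ContinuousMap.ext fun x => by
    change p.1 + q.1 + contract (p.2 + q.2) (x - c) =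
      p.1 + contract p.2 (x - c) + (q.1 + contract q.2 (x - c))
    rw [map_add, LinearMap.add_apply, add_add_add_comm]
  map_smul' r p := ContinuousMap.ext fun x => by
    change r • p.1 + contract (r • p.2) (x - c) = r • (p.1 + contract p.2 (x - c))
    rw [map_smul, LinearMap.smul_apply, smul_add]

/-- The form `x ↦ (x - c) ∧ u + v`. -/
def wedgeForm (c : Pt n) (u v : Cov n) : C(Pt n, Cov n) :=
  ⟨fun x => wedge u (x - c) + v, ((contDiff_linear_sub (wedge u) c).add contDiff_const).continuous⟩

theorem contractForm_apply (c : Pt n) (p : Cov n × Cov n) (x : Pt n) :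
    contractForm c p x = p.1 + contract p.2 (x - c) := rfl

theorem wedgeForm_apply (c : Pt n) (u v : Cov n) (x : Pt n) :
    wedgeForm c u v x = wedge u (x - c) + v := rfl

theorem exists_of_mem_broken_PMinus {k : ℕ} {τ : L2 Ω} (hτ : τ ∈ G.broken fun _ => PMinus n k) :
    ∃ (a : G.cells → Hom n k) (b : G.cells → Hom n (k + 1)),
      τ = G.glue fun T => contractForm (centre T) (a T, b T) := by
  have h : ∀ T : G.cells, ∃ (a : Hom n k) (b : Hom n (k + 1)),
      τ =ᵐ[volume.restrict (T : Set (Pt n))] contractForm (centre T) (a, b) := by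
    intro T
    obtain ⟨p, hp, h⟩ := hτ T T.2
    obtain ⟨a, ha, b, hb, rfl⟩ := (mem_PMinus (centre T)).1 hp
    exact ⟨⟨a, ha⟩, ⟨b, hb⟩, h⟩
  choose a b h using h
  exact ⟨a, b, eq_glue h⟩

theorem dh_contractForm {k : ℕ} (a : G.cells → Hom n k) (b : G.cells → Hom n (k + 1)) :
    G.dh (G.glue fun T => contractForm (centre T) (a T, b T)) =
      G.glue fun T => ContinuousMap.const _ (((k : ℝ) + 1) • (b T : Cov n)) := by
  refine dh_eq_glue _ (glue_ae _)
    (fun T => contDiff_const.add (contDiff_linear_sub _ _)) fun T x => ?_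
  have : fderiv ℝ (contractForm (centre T) (a T, b T)) x =
      LinearMap.toContinuousLinearMap (contract (b T : Cov n)) :=
    ((hasFDerivAt_linear_sub (contract (b T : Cov n)) (centre T) x).const_add (a T : Cov n)).fderiv
  rw [this, extSymbol_contract (b T).2]
  simp

theorem deltah_wedgeForm {k q : ℕ} (hq : k + 1 + q = n) (u : G.cells → Hom n k)
    (v : G.cells → Hom n (k + 1)) :
    G.deltah (k + 1) (G.glue fun T => wedgeForm (centre T) (u T) (v T)) =
      G.glue fun T => ContinuousMap.const _ (-((q : ℝ) + 1) • (u T : Cov n)) := by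
  refine deltah_eq_glue (by omega) (by omega) _ (glue_ae _)
    (fun T => (contDiff_linear_sub _ _).add contDiff_const)
    (fun T x => add_mem (wedge_mem (u T).2 _) (v T).2) fun T x => ?_
  have : fderiv ℝ (wedgeForm (centre T) (u T) (v T)) x =
      LinearMap.toContinuousLinearMap (wedge (u T : Cov n)) :=
    ((hasFDerivAt_linear_sub (wedge (u T : Cov n)) (centre T) x).add_const (v T : Cov n)).fderiv
  rw [this, coSymbol_wedge (q := q + 1) (by omega) (u T).2]
  simp

/-! ### Non-degeneracy of the pairing of broken Whitney forms -/

theorem integral_inner_const_contractForm {T : Set (Pt n)} (hT : T ∈ G.cells) (u a b : Cov n) :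
    ∫ x in T, inner ℝ u (contractForm (centre T) (a, b) x) = volume.real T * inner ℝ u a := by
  have h := integral_clm_sub_centre hT
    ((innerSL ℝ u).comp (LinearMap.toContinuousLinearMap (contract b)))
  simp only [ContinuousLinearMap.comp_apply, LinearMap.coe_toContinuousLinearMap',
    innerSL_apply_apply] at h
  simp only [contractForm_apply, inner_add_right]
  have hc : Continuous fun x => contract b (x - centre T) :=
    (contDiff_linear_sub (contract b) (centre T)).continuous
  rw [integral_add (integrableOn_of_continuous hT continuous_const)
    (integrableOn_of_continuous hT (by fun_prop)), h, setIntegral_const, add_zero, smul_eq_mul]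

/-- The linear part integrates to zero about the centre of mass. This decouples the pairing: u meets
only the constant part of τ, and v only its Koszul part. -/
theorem integral_inner_wedgeForm_const {T : Set (Pt n)} (hT : T ∈ G.cells) (u v b : Cov n) :
    ∫ x in T, inner ℝ (wedgeForm (centre T) u v x) b = volume.real T * inner ℝ v b := by
  have h := integral_clm_sub_centre hT
    ((innerSL ℝ b).comp (LinearMap.toContinuousLinearMap (wedge u)))
  simp only [ContinuousLinearMap.comp_apply, LinearMap.coe_toContinuousLinearMap',
    innerSL_apply_apply] at h
  simp only [wedgeForm_apply, inner_add_left]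
  have hc : Continuous fun x => wedge u (x - centre T) :=
    (contDiff_linear_sub (wedge u) (centre T)).continuous
  simp only [real_inner_comm b] at h ⊢
  rw [integral_add (integrableOn_of_continuous hT (by fun_prop))
    (integrableOn_of_continuous hT continuous_const), h, setIntegral_const, zero_add, smul_eq_mul]

theorem exists_inner_eq {E : Type*} [NormedAddCommGroup E] [InnerProductSpace ℝ E]
    [FiniteDimensional ℝ E] (f : E →ₗ[ℝ] ℝ) : ∃ u : E, ∀ a, inner ℝ u a = f a := by
  have := FiniteDimensional.complete ℝ E
  exact ⟨(InnerProductSpace.toDual ℝ E).symm (LinearMap.toContinuousLinearMap f), fun a => by simp⟩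

/-- The pairing `⟨δ_h η, τ⟩ - ⟨η, d_h τ⟩` represents every linear functional on the broken
Whitney forms. -/
theorem exists_representative {k : ℕ} (hk : k + 1 ≤ n) (f : L2 Ω →ₗ[ℝ] ℝ) :
    ∃ η ∈ G.broken fun _ => PStarMinus n (k + 1), ∀ τ ∈ G.broken fun _ => PMinus n k,
      inner ℝ (G.deltah (k + 1) η) τ - inner ℝ η (G.dh τ) = f τ := by
  classical
  have := Fintype.ofFinite G.cells
  obtain ⟨q, hq⟩ := Nat.exists_eq_add_of_le hk
  -- On each cell the functional splits into its values on constants and on Koszul parts, each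
  -- represented by Riesz within forms of the right degree.
  have h1 : ∀ T : G.cells, ∃ u : Hom n k, ∀ a : Hom n k,
      inner ℝ (u : Cov n) (a : Cov n) = f (G.piece T (contractForm (centre T) (a, 0))) :=
    fun T => exists_inner_eq (f ∘ₗ G.piece T ∘ₗ contractForm (centre T) ∘ₗ
      LinearMap.inl ℝ (Cov n) (Cov n) ∘ₗ (Hom n k).subtype)
  have h2 : ∀ T : G.cells, ∃ v : Hom n (k + 1), ∀ b : Hom n (k + 1),
      inner ℝ (v : Cov n) (b : Cov n) = f (G.piece T (contractForm (centre T) (0, b))) :=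
    fun T => exists_inner_eq (f ∘ₗ G.piece T ∘ₗ contractForm (centre T) ∘ₗ
      LinearMap.inr ℝ (Cov n) (Cov n) ∘ₗ (Hom n (k + 1)).subtype)
  choose u hu using h1
  choose v hv using h2
  -- The rescaling cancels the cell volume, the factors -(q+1) from δ and k+1 from d, and the minus
  -- sign in the pairing.
  let u' : G.cells → Hom n k := fun T =>
    (-(((q : ℝ) + 1) * volume.real (T : Set (Pt n)))⁻¹) • u T
  let v' : G.cells → Hom n (k + 1) := fun T =>
    (-(((k : ℝ) + 1) * volume.real (T : Set (Pt n)))⁻¹) • v T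
  refine ⟨G.glue fun T => wedgeForm (centre T) (u' T) (v' T), fun T hT => ⟨_, ?_,
    glue_ae _ ⟨T, hT⟩⟩, fun τ hτ => ?_⟩
  · exact wedge_add_mem_PStarMinus hk (centre T) (u' ⟨T, hT⟩).2 (v' ⟨T, hT⟩).2
  · obtain ⟨a, b, rfl⟩ := exists_of_mem_broken_PMinus hτ
    rw [dh_contractForm, deltah_wedgeForm hq.symm, inner_glue _ _ _ rfl, inner_glue _ _ _ rfl,
      glue, finsum_eq_sum_of_fintype, finsum_eq_sum_of_fintype, finsum_eq_sum_of_fintype, map_sum,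
      ← Finset.sum_sub_distrib]
    refine Finset.sum_congr rfl fun T _ => ?_
    simp only [ContinuousMap.const_apply]
    rw [integral_inner_const_contractForm T.2, integral_inner_wedgeForm_const T.2]
    have e : ((a T : Cov n), (b T : Cov n)) =
        ((a T : Cov n), (0 : Cov n)) + ((0 : Cov n), (b T : Cov n)) := by simp
    rw [e, map_add, map_add, map_add, ← hu, ← hv]
    have hT := (volume_pos T.2).ne'
    have hq' : (q : ℝ) + 1 ≠ 0 := by positivity
    have hk' : (k : ℝ) + 1 ≠ 0 := by positivity
    simp only [u', v', Submodule.coe_smul, inner_smul_left, inner_smul_right, RCLike.conj_to_real]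
    field_simp
    ring

theorem mem_L2k {k : ℕ} {ω : L2 Ω} :
    ω ∈ L2k Ω k ↔ ∀ᵐ x ∂(volume.restrict Ω), ω x ∈ Hom n k :=
  Iff.rfl

variable (G) in
/-- The conforming Whitney forms as a subspace of `L²`. -/
def WSubmodule (k : ℕ) : Submodule ℝ (L2 Ω) where
  carrier := G.W k
  zero_mem' := by
    refine ⟨fun T hT => ⟨0, zero_mem _, restrict_cell hT (Lp.coeFn_zero _ _ _)⟩, ?_, 0, ?_⟩
    · refine mem_L2k.2 ?_
      filter_upwards [Lp.coeFn_zero (Cov n) 2 (volume.restrict Ω)] with x hx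
      rw [hx]
      exact zero_mem _
    · have e := Lp.coeFn_zero (Cov n) 2 (volume.restrict Ω)
      refine IsWeakD.congr (ω := 0) (η := 0) ?_ e.symm e.symm
      intro φ _ _ _ γ
      simp
  add_mem' := by
    rintro ω ω' ⟨h1, h2, η, h3⟩ ⟨h1', h2', η', h3'⟩
    refine ⟨fun T hT => ?_, ?_, η + η', h3.add subset_rfl h3'⟩
    · obtain ⟨p, hp, h⟩ := h1 T hT
      obtain ⟨p', hp', h'⟩ := h1' T hT
      refine ⟨p + p', add_mem hp hp', ?_⟩
      filter_upwards [restrict_cell hT (Lp.coeFn_add ω ω'), h, h'] with x e e1 e2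
      rw [e, Pi.add_apply, e1, e2, Pi.add_apply]
    · refine mem_L2k.2 ?_
      filter_upwards [Lp.coeFn_add ω ω', mem_L2k.1 h2, mem_L2k.1 h2'] with x e e1 e2
      rw [e]
      exact add_mem e1 e2
  smul_mem' := by
    rintro r ω ⟨h1, h2, η, h3⟩
    refine ⟨fun T hT => ?_, ?_, r • η, h3.smul subset_rfl r⟩
    · obtain ⟨p, hp, h⟩ := h1 T hT
      refine ⟨r • p, Submodule.smul_mem _ _ hp, ?_⟩
      filter_upwards [restrict_cell hT (Lp.coeFn_smul r ω), h] with x e e1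
      rw [e, Pi.smul_apply, e1, Pi.smul_apply]
    · refine mem_L2k.2 ?_
      filter_upwards [Lp.coeFn_smul r ω, mem_L2k.1 h2] with x e e1
      rw [e]
      exact Submodule.smul_mem _ r e1

/-! ### The kernel of `T_h` -/

theorem deltah_of_ae_const {k : ℕ} (hk : 1 ≤ k) (hkn : k ≤ n) {μ : L2 Ω} {a : G.cells → Cov n}
    (ha : ∀ T, a T ∈ Hom n k)
    (h : ∀ T : G.cells, μ =ᵐ[volume.restrict (T : Set (Pt n))] fun _ => a T) :
    G.deltah k μ = 0 := by
  have e : G.deltah k μ = G.glue fun _ => 0 :=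
    deltah_eq_glue hk hkn _ h (fun _ => contDiff_const) (fun T _ => ha T) fun T x => by simp
  rw [e, glue]
  simp

/-- Broken shape functions annihilated by `d_h` and `δ_h` are piecewise constant. -/
theorem exists_const_of_Th_eq_zero {k : ℕ} (hk : 1 ≤ k) (hkn : k ≤ n) {μ : L2 Ω}
    (hμ : μ ∈ G.broken (PmDelta k)) (h : G.Th k μ = 0) :
    ∃ a : G.cells → Cov n, (∀ T, a T ∈ Hom n k) ∧
      ∀ T : G.cells, μ =ᵐ[volume.restrict (T : Set (Pt n))] fun _ => a T := by
  have hloc : ∀ T : G.cells, ∃ a ∈ Hom n k, ∃ b ∈ Hom n (k + 1), ∃ c ∈ Hom n (k - 1),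
      ∃ h ∈ Hom n k, μ =ᵐ[volume.restrict (T : Set (Pt n))] shapeForm T a b c h := by
    intro T
    obtain ⟨p, hp, hμp⟩ := hμ T T.2
    obtain ⟨a, ha, b, hb, c, hc, h, hh, rfl⟩ := exists_of_mem_PmDelta hk hkn hp
    exact ⟨a, ha, b, hb, c, hc, h, hh, hμp⟩
  choose a ha b hb c hc e he hμ using hloc
  obtain ⟨h1, h2⟩ := Prod.mk.inj h
  -- The wedge coefficient c has degree k - 1, so its codifferential carries the factor n - (k - 1).
  have hq : k - 1 + (n - k + 1) = n := by omega
  rw [dh_eq_glue (fun T => ContinuousMap.const _ (((k : ℝ) + 1) • b T)) hμ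
    (fun T => contDiff_shapeForm _ _ _ _ _)
    fun T x => extSymbol_fderiv_shapeForm _ _ _ _ (hb T) x] at h1
  rw [deltah_eq_glue hk hkn (fun T => contractForm (centre T)
      (-((n - k + 1 : ℕ) : ℝ) • c T, (-2 : ℝ) • e T)) hμ
    (fun T => contDiff_shapeForm _ _ _ _ _)
    (fun T => shapeForm_mem_Hom hk _ (ha T) (hb T) (hc T) (he T))
    fun T x => by
      rw [coSymbol_fderiv_shapeForm hq _ _ _ _ (hc T) x, contractForm_apply, map_smul]
      rfl] at h2
  refine ⟨a, ha, fun T => ?_⟩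
  obtain ⟨x, hx⟩ := nonempty_of_mem_cells T.2
  have hb0 : b T = 0 := by
    have := eqOn_zero_of_glue_eq_zero h1 T hx
    rw [ContinuousMap.const_apply] at this
    exact (smul_eq_zero.1 this).resolve_left (by positivity)
  have hloc0 : ∀ y ∈ (T : Set (Pt n)), contractForm (centre T)
      (-((n - k + 1 : ℕ) : ℝ) • c T, (-2 : ℝ) • e T) y = 0 :=
    fun y hy => eqOn_zero_of_glue_eq_zero h2 T hy
  have he0 : e T = 0 := by
    -- The affine codifferential vanishes near x, so its derivative v ↦ v ⌟ (-2e) is zero; applying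
    -- `extSymbol` yields k • (-2e) = 0.
    have hz : HasFDerivAt (fun y => contractForm (centre T)
        (-((n - k + 1 : ℕ) : ℝ) • c T, (-2 : ℝ) • e T) y) (0 : Pt n →L[ℝ] Cov n) x := by
      refine (hasFDerivAt_const (0 : Cov n) x).congr_of_eventuallyEq ?_
      filter_upwards [(isOpen_of_mem_cells T.2).mem_nhds hx] with y hy
      exact hloc0 y hy
    have hu := hz.unique ((hasFDerivAt_linear_sub (contract ((-2 : ℝ) • e T)) (centre T)
      x).const_add (-((n - k + 1 : ℕ) : ℝ) • c T))
    have hs := extSymbol_contract (Submodule.smul_mem _ (-2 : ℝ) (he T))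
    rw [← hu, map_zero] at hs
    have hk0 : (k : ℝ) ≠ 0 := by positivity
    exact (smul_eq_zero.1 ((smul_eq_zero.1 hs.symm).resolve_left hk0)).resolve_left (by norm_num)
  have hc0 : c T = 0 := by
    have := hloc0 x hx
    rw [contractForm_apply, he0] at this
    simp only [smul_zero, map_zero, LinearMap.zero_apply, add_zero] at this
    refine (smul_eq_zero.1 this).resolve_left (neg_ne_zero.2 ?_)
    positivity
  filter_upwards [hμ T] with y hy
  rw [hy, shapeForm, hb0, hc0, he0, muForm_zero]
  simp

end SimplicialSubdivision

end HodgeFEM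

end

/-! ### The two inclusions -/

open HodgeFEM HodgeFEM.SimplicialSubdivision in
theorem mainTheorem7 {n k : ℕ} (hk : 1 ≤ k) (hkn : k + 1 ≤ n)
    {Ω : Set (HodgeFEM.Pt n)} (hΩ : IsOpen Ω) (G : HodgeFEM.SimplicialSubdivision Ω) :
    {μ | μ ∈ G.V k ∧ G.Th k μ = 0} = G.harmonic k := by
  ext μ
  constructor
  · rintro ⟨⟨hμ, hη, hτ⟩, hT⟩
    obtain ⟨a, ha, hμa⟩ := exists_const_of_Th_eq_zero hk (by omega) hμ hT
    obtain ⟨hd, hδ⟩ := Prod.mk.inj hT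
    have hb : μ ∈ G.broken fun _ => PMinus n k := fun T hT =>
      ⟨_, Submodule.mem_sup_left (mem_P0.2 ⟨_, ha ⟨T, hT⟩, rfl⟩), hμa ⟨T, hT⟩⟩
    have hW : μ ∈ G.W k := by
      by_contra hW
      -- A purely algebraic functional with f μ ≠ 0 and f = 0 on the conforming forms suffices; no
      -- continuity is needed.
      obtain ⟨f, hf, hfW⟩ := Submodule.exists_le_ker_of_notMem (p := G.WSubmodule k) hW
      obtain ⟨η, hηb, h⟩ := exists_representative (G := G) hkn f
      have hη0 : η ∈ G.WStarABC0 (k + 1) := by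
        refine ⟨hηb, fun τ hτ => ?_⟩
        -- On conforming τ the defining condition of `WStarABC0` is the pairing with η, that is f τ
        -- = 0.
        rw [extD_eq_dh (G := G) hΩ hτ.2.2, h τ hτ.1]
        exact hfW hτ
      apply hf
      -- Up to sign and symmetry of the inner product, f μ is the first constraint of `V` tested
      -- with η.
      rw [← h μ hb, ← neg_eq_zero, neg_sub, ← hη η hη0, real_inner_comm η, real_inner_comm μ]
    refine ⟨hW, (extD_eq_dh hΩ hW.2.2).trans hd, ?_⟩
    rintro _ ⟨τ, hτW, rfl⟩
    have := hτ τ hτW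
    rwa [hδ, inner_zero_left, zero_sub, neg_eq_zero] at this
  · rintro ⟨hW, hd, ho⟩
    have hdh : G.dh μ = 0 := (extD_eq_dh hΩ hW.2.2).symm.trans hd
    obtain ⟨a, b, rfl⟩ := exists_of_mem_broken_PMinus hW.1
    have hb : ∀ T, (b T : Cov n) = 0 := by
      intro T
      rw [dh_contractForm] at hdh
      obtain ⟨x, hx⟩ := nonempty_of_mem_cells T.2
      have := eqOn_zero_of_glue_eq_zero hdh T hx
      rw [ContinuousMap.const_apply] at this
      exact (smul_eq_zero.1 this).resolve_left (by positivity)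
    have hμa : ∀ T : G.cells, G.glue (fun T => contractForm (centre T) (a T, b T))
        =ᵐ[volume.restrict (T : Set (Pt n))] fun _ => (a T : Cov n) := by
      intro T
      filter_upwards [glue_ae (fun T : G.cells => contractForm (centre (T : Set (Pt n)))
        ((a T : Cov n), (b T : Cov n))) T] with x hx
      rw [hx, contractForm_apply, hb]
      simp
    have hδ := deltah_of_ae_const hk (by omega) (fun T => (a T).2) hμa
    refine ⟨⟨fun T hT => ⟨_, const_mem_PmDelta (a ⟨T, hT⟩).2, hμa ⟨T, hT⟩⟩, fun η hη => ?_,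
      fun τ hτ => ?_⟩, ?_⟩
    -- Here μ itself serves as the conforming test form for η; since dμ = 0, only ⟨δ_h η, μ⟩ = 0
    -- remains.
    · have := hη.2 _ hW
      rw [hd, inner_zero_right, sub_zero] at this
      rw [hdh, inner_zero_left, zero_sub, neg_eq_zero, real_inner_comm]
      exact this
    · rw [hδ, inner_zero_left, zero_sub, neg_eq_zero]
      exact ho _ ⟨τ, hτ, rfl⟩
    · exact Prod.ext hdh hδ
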